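/- Let $d\ge 1$ and let $K:\mathbb{R}^d\to[-\infty,\infty]$ be either $K(x)=\frac{1}{p}|x|^p$ with $-d<p<0$, or $K(x)=\frac1q|x|^q-\frac1p|x|^p$ with $-d<p<0<q$. Let $\mathcal P(\mathbb{R}^d)$ be the set of Borel probability measures on $\mathbb{R}^d$, and let $\mathcal P_2(\mathbb{R}^d)$ be the set of those with finite second moment. For $m>1$ and $\rho\in\mathcal P(\mathbb{R}^d)$, define $$\mathsf E_m(\rho)=\frac12\iint K(x-y)\,\rho(x)\rho(y)\,dx\,dy+\frac1{m-1}\int\rho(x)^m\,dx$$ if $\rho$ is absolutely continuous with respect to Lebesgue measure with density (also denoted $\rho$) in $L^m(\mathbb{R}^d)$, and $\mathsf E_m(\rho)=+\infty$ otherwise. Then there exist $R>0$ and $m_0>1$, depending only on $d$ and $K$, such that for every real $m\ge m_0$ and every minimizer $\rho_m$ of $\mathsf E_m$, over $\mathcal P_2(\mathbb{R}^d)$ or over $\mathcal P(\mathbb{R}^d)$, some translate of $\rho_m$ has its support contained in $B_R(0)$: there is $a\in\mathbb{R}^d$ such that the pushforward of $\rho_m$ under $x\mapsto x-a$ is supported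 in $B_R(0)$. -/

import Mathlib

open MeasureTheory
open scoped ENNReal

noncomputable section

/-- The attractive power-law potential `K(x) = |x|^p / p` on `ℝ^d`. (For `p < 0` its value at the
single point `x = 0` is irrelevant below: the energy is only evaluated on measures with a
density.) -/
def attractivePotential (d : ℕ) (p : ℝ) (x : EuclideanSpace ℝ (Fin d)) : ℝ :=
  ‖x‖ ^ p / p

/-- The repulsive-attractive power-law potential `K(x) = |x|^q / q - |x|^p / p` on `ℝ^d`. -/
def repulsiveAttractivePotential (d : ℕ) (p q : ℝ) (x : EuclideanSpace ℝ (Fin d)) : ℝ :=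
  ‖x‖ ^ q / q - ‖x‖ ^ p / p

/-- The interaction energy `(1/2) ∬ K(x - y) dμ(x) dμ(y)`, with values in `[-∞, ∞]`, as the
integral of the positive part minus the integral of the negative part of `K`. For the potentials
above one of the two parts vanishes, so that no `∞ - ∞` occurs. -/
def interactionEnergy {d : ℕ} (K : EuclideanSpace ℝ (Fin d) → ℝ)
    (μ : Measure (EuclideanSpace ℝ (Fin d))) : EReal :=
  ((2⁻¹ * ∫⁻ x, ∫⁻ y, ENNReal.ofReal (K (x - y)) ∂μ ∂μ : ℝ≥0∞) : EReal) -
    ((2⁻¹ * ∫⁻ x, ∫⁻ y, ENNReal.ofReal (-K (x - y)) ∂μ ∂μ : ℝ≥0∞) : EReal)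

/-- The Rényi entropy `(1/(m-1)) ∫ ρ(x)^m dx`, where `ρ` is the Lebesgue density of `μ`. -/
def renyiEntropy {d : ℕ} (m : ℝ) (μ : Measure (EuclideanSpace ℝ (Fin d))) : ℝ≥0∞ :=
  ENNReal.ofReal (1 / (m - 1)) * ∫⁻ x, μ.rnDeriv volume x ^ m

open Classical in
/-- The aggregation-diffusion energy `E_m` with interaction potential `K`: interaction energy plus
Rényi entropy if `μ` is absolutely continuous with a density in `L^m(ℝ^d)`, and `+∞` otherwise. -/
def energy {d : ℕ} (K : EuclideanSpace ℝ (Fin d) → ℝ) (m : ℝ)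
    (μ : Measure (EuclideanSpace ℝ (Fin d))) : EReal :=
  if μ ≪ volume ∧ MemLp (fun x => (μ.rnDeriv volume x).toReal) (ENNReal.ofReal m) volume then
    interactionEnergy K μ + (renyiEntropy m μ : EReal)
  else ⊤

/-- `P₂(ℝ^d)`: the Borel probability measures on `ℝ^d` with finite second moment. -/
def finiteSecondMoment (d : ℕ) : Set (ProbabilityMeasure (EuclideanSpace ℝ (Fin d))) :=
  {μ | ∫⁻ x, ‖x‖ₑ ^ 2 ∂(μ : Measure (EuclideanSpace ℝ (Fin d))) < ∞}

/-- `μ` is a minimizer of `E_m` over the class `𝒜` of probability measures. -/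
def IsEnergyMinimizer {d : ℕ} (K : EuclideanSpace ℝ (Fin d) → ℝ) (m : ℝ)
    (𝒜 : Set (ProbabilityMeasure (EuclideanSpace ℝ (Fin d))))
    (μ : ProbabilityMeasure (EuclideanSpace ℝ (Fin d))) : Prop :=
  μ ∈ 𝒜 ∧ ∀ ν ∈ 𝒜, energy K m μ ≤ energy K m ν

end

/-! In both cases `K` has a constant sign `σ`, so with `V = ∬ |K|` and `F = ∫ ρ^m` the energy is `σ
V / 2 + F / (m - 1)`. Three consequences of minimality, with constants independent of `m`, give the
result. Comparison with a normalised ball of density at most one bounds the energy, because `F ≤ 1`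
for that competitor. Dilations give a virial identity (`IsRegularMinimizer.virial`) linking `F` to
the interaction energy. Removing mass from a set and renormalising gives a one-sided Euler–Lagrange
inequality (`IsRegularMinimizer.setLIntegral_potential_le`), which bounds the potential of `ρ`
almost everywhere on `ρ`.

Repulsive-attractive case: comparison bounds `V`, the virial identity then bounds `F`, and so the
potential is bounded above. It dominates `∫ |x - y|^q / q dρ(y)`; the triangle inequality applied to
two such points bounds their distance.

Attractive case: the potential of `|K|` is bounded below by a multiplier, and the virial identity
together with `p > -d` keeps this multiplier away from zero. Fix `s` with `-d < s < p`. For large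
`m`, Young's inequality bounds the near-field part of the potential by `∫ |x|^s` over a small ball
plus `F / m`, both small; the far field is small as well. So every ball of a fixed radius `t` around
almost every point carries mass at least some fixed `δ`. This alone does not prevent widely
separated clumps. But a slab of zero mass between two parts of `ρ` could be narrowed, leaving `F`
unchanged and strictly increasing the attraction (`IsRegularMinimizer.measure_lt_eq_zero_or`). Hence
no coordinate has gaps of length `t`, and since the total mass is one, each coordinate ranges over a
bounded interval (`exists_ae_abs_coord_sub_le`). -/

section AggregationDiffusion

open Filter Topology

variable {d : ℕ}

/-! ### The energy as a real number -/

/-- The mutual interaction `∬ k(x - y) dμ(x) dν(y)` of two measures for a nonnegative kernel. -/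
noncomputable def mutualInteraction (k : EuclideanSpace ℝ (Fin d) → ℝ≥0∞)
    (μ ν : Measure (EuclideanSpace ℝ (Fin d))) : ℝ≥0∞ :=
  ∫⁻ x, ∫⁻ y, k (x - y) ∂ν ∂μ

/-- The integral `∫ ρ^m` of a power of the Lebesgue density `ρ` of `μ`. -/
noncomputable def densityPower (m : ℝ) (μ : Measure (EuclideanSpace ℝ (Fin d))) : ℝ≥0∞ :=
  ∫⁻ x, μ.rnDeriv volume x ^ m

theorem memLp_toReal_rnDeriv_iff {m : ℝ} (hm : 1 < m)
    (μ : Measure (EuclideanSpace ℝ (Fin d))) [IsFiniteMeasure μ] :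
    MemLp (fun x => (μ.rnDeriv volume x).toReal) (ENNReal.ofReal m) volume ↔
      densityPower m μ ≠ ∞ := by
  have h0 : ENNReal.ofReal m ≠ 0 := by simp; linarith
  have hmeas : AEStronglyMeasurable (fun x => (μ.rnDeriv volume x).toReal) volume :=
    (Measure.measurable_rnDeriv μ volume).ennreal_toReal.aestronglyMeasurable
  have hint : ∫⁻ x, ‖(μ.rnDeriv volume x).toReal‖ₑ ^ m = densityPower m μ := by
    refine lintegral_congr_ae ?_
    filter_upwards [Measure.rnDeriv_lt_top μ volume] with x hx
    rw [Real.enorm_eq_ofReal ENNReal.toReal_nonneg, ENNReal.ofReal_toReal hx.ne]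
  rw [MemLp, and_iff_right hmeas, eLpNorm_lt_top_iff_lintegral_rpow_enorm_lt_top h0
    ENNReal.ofReal_ne_top, ENNReal.toReal_ofReal (by linarith), hint, lt_top_iff_ne_top]

theorem energy_ne_top_imp {K : EuclideanSpace ℝ (Fin d) → ℝ} {m : ℝ} (hm : 1 < m)
    {μ : Measure (EuclideanSpace ℝ (Fin d))} [IsFiniteMeasure μ] (h : energy K m μ ≠ ⊤) :
    μ ≪ volume ∧ densityPower m μ ≠ ∞ := by
  rw [← memLp_toReal_rnDeriv_iff hm]
  by_contra hcon
  exact h (if_neg hcon)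

theorem ennreal_coe_ereal_eq {a : ℝ≥0∞} (ha : a ≠ ∞) : (a : EReal) = ((a.toReal : ℝ) : EReal) := by
  lift a to NNReal using ha
  rfl

/-- The sign condition makes one of the two parts in `interactionEnergy` vanish, so a single formula
in `σ` serves both potentials and later arguments can be carried out in `ℝ`. -/
theorem energy_eq_coe {K : EuclideanSpace ℝ (Fin d) → ℝ} {σ : ℝ} (hσ : σ = 1 ∨ σ = -1)
    (hK : ∀ x, 0 ≤ σ * K x) {m : ℝ} (hm : 1 < m)
    {μ : Measure (EuclideanSpace ℝ (Fin d))} [IsFiniteMeasure μ] (hμ : μ ≪ volume)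
    (hF : densityPower m μ ≠ ∞)
    (hV : mutualInteraction (fun x => ENNReal.ofReal (σ * K x)) μ μ ≠ ∞) :
    energy K m μ =
      ((σ / 2 * (mutualInteraction (fun x => ENNReal.ofReal (σ * K x)) μ μ).toReal +
        (densityPower m μ).toReal / (m - 1) : ℝ) : EReal) := by
  have hF' : (renyiEntropy m μ : EReal) = (((densityPower m μ).toReal / (m - 1) : ℝ) : EReal) := by
    rw [renyiEntropy, ← densityPower, ennreal_coe_ereal_eq (ENNReal.mul_ne_top ENNReal.ofReal_ne_top hF),
      ENNReal.toReal_mul, ENNReal.toReal_ofReal (by simp; linarith)]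
    congr 1
    ring
  rw [energy, if_pos ⟨hμ, (memLp_toReal_rnDeriv_iff hm μ).2 hF⟩, hF', EReal.coe_add]
  congr 1
  have h2 : ENNReal.toReal 2⁻¹ = 2⁻¹ := by simp
  rcases hσ with rfl | rfl
  · have hneg : ∀ x, ENNReal.ofReal (-K x) = 0 := fun x =>
      ENNReal.ofReal_of_nonpos (by have := hK x; linarith)
    simp only [one_mul, mutualInteraction] at hV ⊢
    simp only [interactionEnergy, hneg, lintegral_zero, mul_zero]
    rw [ennreal_coe_ereal_eq (ENNReal.mul_ne_top (by simp) hV), ENNReal.toReal_mul, h2]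
    simp
  · have hpos : ∀ x, ENNReal.ofReal (K x) = 0 := fun x =>
      ENNReal.ofReal_of_nonpos (by have := hK x; linarith)
    simp only [neg_mul, one_mul, mutualInteraction] at hV ⊢
    simp only [interactionEnergy, hpos, lintegral_zero, mul_zero]
    rw [ennreal_coe_ereal_eq (ENNReal.mul_ne_top (by simp) hV), ENNReal.toReal_mul, h2]
    rw [EReal.coe_ennreal_zero, zero_sub, ← EReal.coe_neg]
    congr 1
    ring

/-- The entropy is nonnegative and cannot compensate an infinite positive interaction. For negative
potentials finiteness comes instead from the Riesz energy bound. -/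
theorem mutualInteraction_ne_top_of_energy_ne_top {K : EuclideanSpace ℝ (Fin d) → ℝ}
    (hK : ∀ x, 0 ≤ K x) {m : ℝ} {μ : Measure (EuclideanSpace ℝ (Fin d))}
    (h : energy K m μ ≠ ⊤) :
    mutualInteraction (fun x => ENNReal.ofReal (K x)) μ μ ≠ ∞ := by
  intro htop
  have hneg : ∀ x, ENNReal.ofReal (-K x) = 0 := fun x =>
    ENNReal.ofReal_of_nonpos (by have := hK x; linarith)
  apply h
  rw [energy]
  split_ifs
  · simp only [mutualInteraction] at htop
    simp only [interactionEnergy, hneg, lintegral_zero, mul_zero, htop]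
    rw [ENNReal.mul_top (by simp)]
    simp only [EReal.coe_ennreal_top, EReal.coe_ennreal_zero, sub_zero]
    exact EReal.top_add_of_ne_bot (by simp)
  · rfl

/-! ### Densities of transformed measures -/

theorem rnDeriv_le_of_le_smul {μ ν : Measure (EuclideanSpace ℝ (Fin d))} [IsFiniteMeasure ν]
    [SigmaFinite μ] {C : ℝ≥0∞} (hμ : μ ≪ volume) (h : ν ≤ C • μ) :
    ν.rnDeriv volume ≤ᵐ[volume] fun x => C * μ.rnDeriv volume x := by
  refine ae_le_of_forall_setLIntegral_le_of_sigmaFinite (Measure.measurable_rnDeriv ν volume)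
    fun s hs _ => ?_
  rw [lintegral_const_mul _ (Measure.measurable_rnDeriv μ volume),
    Measure.setLIntegral_rnDeriv hμ]
  exact (Measure.setLIntegral_rnDeriv_le s).trans (h s)

theorem densityPower_le_of_le_smul {μ ν : Measure (EuclideanSpace ℝ (Fin d))} [IsFiniteMeasure ν]
    [SigmaFinite μ] {C : ℝ≥0∞} (hμ : μ ≪ volume) (h : ν ≤ C • μ) {m : ℝ} (hm : 0 ≤ m) :
    densityPower m ν ≤ C ^ m * densityPower m μ := by
  rw [densityPower, densityPower,
    ← lintegral_const_mul _ ((Measure.measurable_rnDeriv μ volume).pow_const m)]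
  refine lintegral_mono_ae ?_
  filter_upwards [rnDeriv_le_of_le_smul hμ h] with x hx
  rw [← ENNReal.mul_rpow_of_nonneg _ _ hm]
  exact ENNReal.rpow_le_rpow hx hm

/-- A density at most one satisfies `ρ^m ≤ ρ`. The bound does not depend on `m`, which is what makes
the competitor uniform. -/
theorem densityPower_le_one {ν : Measure (EuclideanSpace ℝ (Fin d))} [IsProbabilityMeasure ν]
    (h : ν ≤ volume) {m : ℝ} (hm : 1 ≤ m) : densityPower m ν ≤ 1 := by
  have hle : ν.rnDeriv volume ≤ᵐ[volume] 1 := by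
    refine ae_le_of_forall_setLIntegral_le_of_sigmaFinite (Measure.measurable_rnDeriv ν volume)
      fun s hs _ => ?_
    simpa using (Measure.setLIntegral_rnDeriv_le s).trans (h s)
  calc densityPower m ν ≤ ∫⁻ x, ν.rnDeriv volume x := by
        refine lintegral_mono_ae ?_
        filter_upwards [hle] with x hx
        simpa using ENNReal.rpow_le_rpow_of_exponent_ge hx hm
    _ ≤ ν Set.univ := Measure.lintegral_rnDeriv_le
    _ = 1 := measure_univ

/-- Change of variables: the new density at `f x` is `c` times the old one at `x`, and the volume
element contributes `c⁻¹`. It is used for dilations and, with `c = 1`, for translations. -/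
theorem densityPower_map {μ : Measure (EuclideanSpace ℝ (Fin d))} [IsFiniteMeasure μ]
    {f : EuclideanSpace ℝ (Fin d) → EuclideanSpace ℝ (Fin d)} (hf : MeasurableEmbedding f)
    {c : ℝ≥0∞} (hc : c ≠ 0) (hc' : c ≠ ∞) (hmap : volume.map f = c • volume) {m : ℝ}
    (hm : 0 < m) : densityPower m (μ.map f) = c ^ (m - 1) * densityPower m μ := by
  have hsf : SigmaFinite (volume.map f) := by
    rw [hmap]
    lift c to NNReal using hc'
    exact inferInstanceAs (SigmaFinite (c • volume))
  have h1 := hf.rnDeriv_map μ volume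
  have h2 : (μ.map f).rnDeriv (volume.map f) =ᵐ[volume]
      fun x => c⁻¹ * (μ.map f).rnDeriv volume x := by
    rw [hmap]
    exact Measure.rnDeriv_smul_right_of_ne_top' _ _ hc hc'
  have key : densityPower m μ = c * (c⁻¹ ^ m * densityPower m (μ.map f)) := by
    calc densityPower m μ
        = ∫⁻ x, ((μ.map f).rnDeriv (volume.map f) (f x)) ^ m := by
          refine lintegral_congr_ae ?_
          filter_upwards [h1] with x hx
          rw [← hx]
      _ = ∫⁻ x, ((μ.map f).rnDeriv (volume.map f) x) ^ m ∂(volume.map f) :=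
          (hf.lintegral_map (μ := volume)
            (fun x => ((μ.map f).rnDeriv (volume.map f) x) ^ m)).symm
      _ = c * ∫⁻ x, ((μ.map f).rnDeriv (volume.map f) x) ^ m := by
          generalize (fun x => ((μ.map f).rnDeriv (volume.map f) x) ^ m) = G
          rw [hmap, lintegral_smul_measure, smul_eq_mul]
      _ = c * (c⁻¹ ^ m * densityPower m (μ.map f)) := by
          congr 1
          rw [densityPower, ← lintegral_const_mul _
            ((Measure.measurable_rnDeriv (μ.map f) volume).pow_const m)]
          refine lintegral_congr_ae ?_
          filter_upwards [h2] with x hx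
          rw [hx, ENNReal.mul_rpow_of_nonneg _ _ hm.le]
  rw [key, ← mul_assoc, ← mul_assoc]
  have hcc : c ^ (m - 1) * c * c⁻¹ ^ m = 1 := by
    nth_rewrite 2 [← ENNReal.rpow_one c]
    rw [← ENNReal.rpow_add _ _ hc hc', ENNReal.inv_rpow, sub_add_cancel]
    exact ENNReal.mul_inv_cancel (by simp [hc, hc']) (by simp [hc, hc'])
  rw [hcc, one_mul]

theorem densityPower_eq_restrict_add {μ : Measure (EuclideanSpace ℝ (Fin d))} [IsFiniteMeasure μ]
    {s : Set (EuclideanSpace ℝ (Fin d))} (hs : MeasurableSet s) {m : ℝ} (hm : 0 < m) :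
    densityPower m μ = densityPower m (μ.restrict s) + densityPower m (μ.restrict sᶜ) := by
  have key : ∀ {t : Set (EuclideanSpace ℝ (Fin d))}, MeasurableSet t →
      densityPower m (μ.restrict t) = ∫⁻ x in t, μ.rnDeriv volume x ^ m := by
    intro t ht
    rw [← lintegral_indicator ht]
    refine lintegral_congr_ae ?_
    filter_upwards [Measure.rnDeriv_restrict μ volume ht] with x hx
    rw [hx]
    by_cases hxt : x ∈ t <;> simp [hxt, hm]
  rw [key hs, key hs.compl, densityPower, lintegral_add_compl _ hs]

/-! ### Riesz kernels -/

/-- The kernel `|x|^s` with values in `[0, ∞]`. -/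
noncomputable def rieszKernel (s : ℝ) (x : EuclideanSpace ℝ (Fin d)) : ℝ≥0∞ :=
  ENNReal.ofReal (‖x‖ ^ s)

theorem measurable_rieszKernel (s : ℝ) :
    Measurable (rieszKernel s : EuclideanSpace ℝ (Fin d) → ℝ≥0∞) :=
  (measurable_norm.pow_const s).ennreal_ofReal

theorem rieszKernel_smul {t : ℝ} (ht : 0 < t) (s : ℝ) (x : EuclideanSpace ℝ (Fin d)) :
    rieszKernel s (t • x) = ENNReal.ofReal (t ^ s) * rieszKernel s x := by
  rw [rieszKernel, rieszKernel, ← ENNReal.ofReal_mul (by positivity), norm_smul,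
    Real.mul_rpow (by positivity) (by positivity), Real.norm_of_nonneg ht.le]

/-- In polar coordinates the integrand is `y^(d - 1 + s)` on `(0, 1)`, with exponent above `-1`. -/
theorem setLIntegral_ball_rieszKernel_ne_top [NeZero d] {s : ℝ} (hs : -(d : ℝ) < s) :
    ∫⁻ x in Metric.ball (0 : EuclideanSpace ℝ (Fin d)) 1, rieszKernel s x ≠ ∞ := by
  have hint : IntegrableOn (fun x : EuclideanSpace ℝ (Fin d) => ‖x‖ ^ s) (Metric.ball 0 1) := by
    rw [integrableOn_fun_norm_addHaar volume (f := fun y : ℝ => y ^ s)]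
    have h1 : IntegrableOn (fun y : ℝ => y ^ ((d : ℝ) - 1 + s)) (Set.Ioo 0 1) :=
      (intervalIntegral.integrableOn_Ioo_rpow_iff one_pos).2 (by linarith)
    refine h1.congr_fun (fun y hy => ?_) measurableSet_Ioo
    have hd : 1 ≤ d := Nat.one_le_iff_ne_zero.2 (NeZero.ne d)
    simp only [finrank_euclideanSpace, Fintype.card_fin, smul_eq_mul]
    rw [Real.rpow_add hy.1, ← Real.rpow_natCast, Nat.cast_sub hd, Nat.cast_one]
  have := hint.2
  rw [hasFiniteIntegral_iff_ofReal (Eventually.of_forall fun x => by positivity)] at this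
  exact this.ne

theorem exists_setLIntegral_ball_rieszKernel_le [NeZero d] {s : ℝ} (hs : -(d : ℝ) < s)
    {η : ℝ≥0∞} (hη : 0 < η) : ∃ ε : ℝ, 0 < ε ∧ ε ≤ 1 ∧
      ∫⁻ x in Metric.ball (0 : EuclideanSpace ℝ (Fin d)) ε, rieszKernel s x ≤ η := by
  have h0 : Tendsto (fun ε : ℝ => volume (Metric.ball (0 : EuclideanSpace ℝ (Fin d)) ε))
      (𝓝[>] 0) (𝓝 0) := by
    have h1 : Tendsto (fun ε : ℝ => ENNReal.ofReal (ε ^ d) *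
        volume (Metric.ball (0 : EuclideanSpace ℝ (Fin d)) 1)) (𝓝[>] 0) (𝓝 0) := by
      have h2 : Tendsto (fun ε : ℝ => ENNReal.ofReal (ε ^ d)) (𝓝[>] 0) (𝓝 0) := by
        have : Continuous fun ε : ℝ => ENNReal.ofReal (ε ^ d) :=
          ENNReal.continuous_ofReal.comp (continuous_pow d)
        simpa [NeZero.ne d] using (this.tendsto 0).mono_left (nhdsWithin_le_nhds (s := Set.Ioi 0))
      simpa using ENNReal.Tendsto.mul_const h2 (Or.inr measure_ball_lt_top.ne)
    refine h1.congr' ?_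
    filter_upwards [self_mem_nhdsWithin] with ε hε
    rw [Measure.addHaar_ball volume 0 (le_of_lt hε)]
    simp
  have h3 : Tendsto (fun ε : ℝ => (volume.restrict (Metric.ball 0 1))
      (Metric.ball (0 : EuclideanSpace ℝ (Fin d)) ε)) (𝓝[>] 0) (𝓝 0) :=
    tendsto_of_tendsto_of_tendsto_of_le_of_le tendsto_const_nhds h0 (fun _ => zero_le)
      fun ε => Measure.restrict_apply_le _ _
  have h4 := tendsto_setLIntegral_zero (setLIntegral_ball_rieszKernel_ne_top hs) h3
  have h5 : ∀ᶠ ε : ℝ in 𝓝[>] 0, 0 < ε ∧ ε ≤ 1 :=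
    Filter.mem_of_superset (Ioc_mem_nhdsGT one_pos) fun _ hx => hx
  obtain ⟨ε, hε, hε0, hε1⟩ := ((h4.eventually (ge_mem_nhds hη)).and h5).exists
  refine ⟨ε, hε0, hε1, ?_⟩
  rwa [Measure.restrict_restrict measurableSet_ball,
    Set.inter_eq_left.2 (Metric.ball_subset_ball hε1)] at hε

/-- Young's inequality bounds the near-field potential of a measure with density in `L^m`. -/
theorem setLIntegral_ball_rieszKernel_sub_le {p s m ε : ℝ} (hp : p < 0) (hm : 1 < m)
    (hs : s ≤ p * (m / (m - 1))) (hε : ε ≤ 1) {μ : Measure (EuclideanSpace ℝ (Fin d))}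
    [IsFiniteMeasure μ] (hμ : μ ≪ volume) (x : EuclideanSpace ℝ (Fin d)) :
    ∫⁻ y in Metric.ball x ε, rieszKernel p (x - y) ∂μ ≤
      (∫⁻ y in Metric.ball (0 : EuclideanSpace ℝ (Fin d)) ε, rieszKernel s y) +
        densityPower m μ / ENNReal.ofReal m := by
  have hconj : (m / (m - 1)).HolderConjugate m := (Real.HolderConjugate.conjExponent hm).symm
  set q := m / (m - 1) with hq
  have hρ := Measure.measurable_rnDeriv μ volume
  have hk : Measurable fun y => rieszKernel p (x - y) :=
    (measurable_rieszKernel p).comp (measurable_const.sub measurable_id)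
  have hks : Measurable fun y => rieszKernel s (x - y) :=
    (measurable_rieszKernel s).comp (measurable_const.sub measurable_id)
  have hpt : ∀ y ∈ Metric.ball x ε, μ.rnDeriv volume y * rieszKernel p (x - y) ≤
      rieszKernel s (x - y) + μ.rnDeriv volume y ^ m / ENNReal.ofReal m := by
    intro y hy
    rw [mul_comm]
    refine (ENNReal.young_inequality _ _ hconj).trans (add_le_add_left ?_ _)
    -- The factor `1 / q ≤ 1` from Young's inequality is dropped; the factor `1 / m` on the density
    -- is kept, as it makes that term small for large `m`.
    have h1 : rieszKernel p (x - y) ^ q / ENNReal.ofReal q ≤ rieszKernel p (x - y) ^ q :=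
      ENNReal.div_le_of_le_mul (le_mul_of_one_le_right zero_le
        (by rw [ENNReal.one_le_ofReal]; exact hconj.lt.le))
    refine h1.trans ?_
    rw [rieszKernel, rieszKernel, ENNReal.ofReal_rpow_of_nonneg (by positivity) hconj.pos.le,
      ← Real.rpow_mul (norm_nonneg _)]
    refine ENNReal.ofReal_le_ofReal ?_
    rcases eq_or_ne (x - y) 0 with h0 | h0
    -- On the diagonal the real power of `0` with negative exponent is `0`, so the left side
    -- vanishes.
    · rw [h0, norm_zero]
      rw [Real.zero_rpow (mul_neg_of_neg_of_pos hp hconj.pos).ne]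
      positivity
    · refine Real.rpow_le_rpow_of_exponent_ge (norm_pos_iff.2 h0) ?_ hs
      rw [← dist_eq_norm, dist_comm]
      exact (Metric.mem_ball.1 hy).le.trans hε
  have htrans : ∫⁻ y in Metric.ball x ε, rieszKernel s (x - y) =
      ∫⁻ y in Metric.ball (0 : EuclideanSpace ℝ (Fin d)) ε, rieszKernel s y := by
    rw [← lintegral_indicator measurableSet_ball, ← lintegral_indicator measurableSet_ball,
      ← lintegral_sub_left_eq_self _ x]
    refine lintegral_congr fun y => ?_
    simp [Set.indicator, dist_eq_norm]
  calc ∫⁻ y in Metric.ball x ε, rieszKernel p (x - y) ∂μ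
      = ∫⁻ y in Metric.ball x ε, μ.rnDeriv volume y * rieszKernel p (x - y) := by
        conv_lhs => rw [← Measure.withDensity_rnDeriv_eq μ volume hμ]
        exact setLIntegral_withDensity_eq_setLIntegral_mul _ hρ hk measurableSet_ball
    _ ≤ ∫⁻ y in Metric.ball x ε,
          (rieszKernel s (x - y) + μ.rnDeriv volume y ^ m / ENNReal.ofReal m) :=
        setLIntegral_mono (hks.add ((hρ.pow_const m).div_const _)) hpt
    _ = (∫⁻ y in Metric.ball (0 : EuclideanSpace ℝ (Fin d)) ε, rieszKernel s y) +
          ∫⁻ y in Metric.ball x ε, μ.rnDeriv volume y ^ m / ENNReal.ofReal m := by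
        rw [lintegral_add_left hks, htrans]
    _ ≤ _ := by
        gcongr
        refine (setLIntegral_le_lintegral _ _).trans ?_
        simp only [div_eq_mul_inv]
        rw [lintegral_mul_const _ (hρ.pow_const m), densityPower]

/-- Near, intermediate and far field bound for the potential of a probability measure. -/
theorem lintegral_rieszKernel_sub_le {p s m ε r : ℝ} (hp : p < 0) (hm : 1 < m)
    (hs : s ≤ p * (m / (m - 1))) (hε0 : 0 < ε) (hε : ε ≤ 1) (hr : 0 < r)
    {μ : Measure (EuclideanSpace ℝ (Fin d))}
    [IsProbabilityMeasure μ] (hμ : μ ≪ volume) (x : EuclideanSpace ℝ (Fin d)) :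
    ∫⁻ y, rieszKernel p (x - y) ∂μ ≤
      (∫⁻ y in Metric.ball (0 : EuclideanSpace ℝ (Fin d)) ε, rieszKernel s y) +
        densityPower m μ / ENNReal.ofReal m +
        ENNReal.ofReal (ε ^ p) * μ (Metric.ball x r) + ENNReal.ofReal (r ^ p) := by
  have hk : Measurable fun y => rieszKernel p (x - y) :=
    (measurable_rieszKernel p).comp (measurable_const.sub measurable_id)
  have hmono : ∀ {a : ℝ}, 0 < a → ∀ {y}, y ∉ Metric.ball x a →
      rieszKernel p (x - y) ≤ ENNReal.ofReal (a ^ p) := by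
    intro a ha y hy
    refine ENNReal.ofReal_le_ofReal (Real.rpow_le_rpow_of_nonpos ha ?_ hp.le)
    rw [← dist_eq_norm, dist_comm]
    simpa using hy
  have hpt : ∀ y, rieszKernel p (x - y) ≤
      (Metric.ball x ε).indicator (fun y => rieszKernel p (x - y)) y +
        (Metric.ball x r).indicator (fun _ => ENNReal.ofReal (ε ^ p)) y +
          ENNReal.ofReal (r ^ p) := by
    intro y
    by_cases h1 : y ∈ Metric.ball x ε
    · rw [Set.indicator_of_mem h1, add_assoc]
      exact le_self_add
    · by_cases h2 : y ∈ Metric.ball x r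
      · rw [Set.indicator_of_notMem h1, Set.indicator_of_mem h2, zero_add]
        exact (hmono hε0 h1).trans le_self_add
      · exact (hmono hr h2).trans le_add_self
  refine (lintegral_mono hpt).trans ?_
  rw [lintegral_add_right _ measurable_const, lintegral_add_right _
    (measurable_const.indicator measurableSet_ball), lintegral_indicator measurableSet_ball,
    lintegral_indicator measurableSet_ball, setLIntegral_const,
    lintegral_const, measure_univ, mul_one]
  gcongr
  exact setLIntegral_ball_rieszKernel_sub_le hp hm hs hε hμ x

/-- A normalised ball of volume at least one. -/
theorem exists_probabilityMeasure_le_volume [NeZero d] :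
    ∃ r : ℝ, 0 < r ∧ ∃ ν : Measure (EuclideanSpace ℝ (Fin d)), IsProbabilityMeasure ν ∧
      ν ≤ volume ∧ ∀ᵐ x ∂ν, ‖x‖ ≤ r := by
  set v := volume (Metric.ball (0 : EuclideanSpace ℝ (Fin d)) 1) with hv
  have hv0 : 0 < v := Metric.measure_ball_pos _ _ one_pos
  have hvt : v ≠ ∞ := measure_ball_lt_top.ne
  -- With `r ≥ 1` and `r ≥ 1 / v`, the volume `r^d v ≥ r v` is at least one.
  set r := max 1 v.toReal⁻¹ with hr
  have hr0 : 0 < r := lt_of_lt_of_le one_pos (le_max_left _ _)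
  have hvol : 1 ≤ volume (Metric.ball (0 : EuclideanSpace ℝ (Fin d)) r) := by
    rw [Measure.addHaar_ball volume 0 hr0.le, ← hv, ← ENNReal.ofReal_toReal hvt,
      ← ENNReal.ofReal_mul (by positivity), ENNReal.one_le_ofReal]
    have hpos : 0 < v.toReal := ENNReal.toReal_pos hv0.ne' hvt
    have h1 : r ≤ r ^ Module.finrank ℝ (EuclideanSpace ℝ (Fin d)) :=
      le_self_pow₀ (le_max_left _ _) (by simpa using NeZero.ne d)
    calc 1 = v.toReal⁻¹ * v.toReal := (inv_mul_cancel₀ hpos.ne').symm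
      _ ≤ _ := by gcongr; exact (le_max_right _ _).trans h1
  refine ⟨r, hr0, ProbabilityTheory.cond volume (Metric.ball 0 r),
    ProbabilityTheory.cond_isProbabilityMeasure_of_finite (by positivity)
      measure_ball_lt_top.ne, ?_, ?_⟩
  · intro s
    rw [ProbabilityTheory.cond_apply measurableSet_ball]
    calc _ ≤ 1 * volume s := by
          gcongr
          · exact ENNReal.inv_le_one.2 hvol
          · exact Set.inter_subset_right
      _ = _ := one_mul _
  · rw [ProbabilityTheory.cond]
    refine Measure.ae_smul_measure ?_ _
    filter_upwards [ae_restrict_mem measurableSet_ball] with x hx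
    simpa using (Metric.mem_ball.1 hx).le

/-! ### Minimality and its first-order consequences -/

/-- `μ` has least energy among the probability measures whose second moment is controlled by that
of `μ`. -/
def IsMomentMinimizer (K : EuclideanSpace ℝ (Fin d) → ℝ) (m : ℝ)
    (μ : Measure (EuclideanSpace ℝ (Fin d))) : Prop :=
  ∀ ν : Measure (EuclideanSpace ℝ (Fin d)), IsProbabilityMeasure ν →
    (∃ C : ℝ≥0∞, C ≠ ∞ ∧ ∫⁻ x, ‖x‖ₑ ^ 2 ∂ν ≤ C * (∫⁻ x, ‖x‖ₑ ^ 2 ∂μ + 1)) →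
      energy K m μ ≤ energy K m ν

theorem IsEnergyMinimizer.isMomentMinimizer {K : EuclideanSpace ℝ (Fin d) → ℝ} {m : ℝ}
    {μ : ProbabilityMeasure (EuclideanSpace ℝ (Fin d))}
    (h : IsEnergyMinimizer K m (finiteSecondMoment d) μ ∨ IsEnergyMinimizer K m Set.univ μ) :
    IsMomentMinimizer K m (μ : Measure (EuclideanSpace ℝ (Fin d))) := by
  rintro ν hν ⟨C, hC, hle⟩
  rcases h with h | h
  · refine h.2 ⟨ν, hν⟩ (hle.trans_lt ?_)
    exact ENNReal.mul_lt_top hC.lt_top (ENNReal.add_lt_top.2 ⟨h.1, ENNReal.one_lt_top⟩)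
  · exact h.2 ⟨ν, hν⟩ trivial

theorem nonneg_of_hasDerivAt_of_le {f : ℝ → ℝ} {f' : ℝ} (hf : HasDerivAt f f' 0)
    (hle : ∀ s, 0 < s → s < 1 → f 0 ≤ f s) : 0 ≤ f' := by
  refine ge_of_tendsto hf.tendsto_slope_zero_right ?_
  filter_upwards [Ioo_mem_nhdsGT one_pos] with s hs
  have := hle s hs.1 hs.2
  rw [zero_add, smul_eq_mul]
  exact mul_nonneg (inv_nonneg.2 hs.1.le) (by linarith)

/-! ### Bilinearity and symmetry of the interaction -/

section MutualInteraction

variable {k : EuclideanSpace ℝ (Fin d) → ℝ≥0∞}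

theorem measurable_potential (hk : Measurable k) (ν : Measure (EuclideanSpace ℝ (Fin d)))
    [SFinite ν] : Measurable fun x => ∫⁻ y, k (x - y) ∂ν :=
  (hk.comp measurable_sub).lintegral_prod_right'

theorem mutualInteraction_add_left (μ μ' ν : Measure (EuclideanSpace ℝ (Fin d))) :
    mutualInteraction k (μ + μ') ν = mutualInteraction k μ ν + mutualInteraction k μ' ν :=
  lintegral_add_measure _ _ _

theorem mutualInteraction_add_right (hk : Measurable k)
    (μ ν ν' : Measure (EuclideanSpace ℝ (Fin d))) [SFinite ν] :
    mutualInteraction k μ (ν + ν') = mutualInteraction k μ ν + mutualInteraction k μ ν' := by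
  simp only [mutualInteraction, lintegral_add_measure]
  rw [lintegral_add_left (measurable_potential hk ν)]

theorem mutualInteraction_smul_left (c : ℝ≥0∞) (μ ν : Measure (EuclideanSpace ℝ (Fin d))) :
    mutualInteraction k (c • μ) ν = c * mutualInteraction k μ ν := by
  rw [mutualInteraction, lintegral_smul_measure, smul_eq_mul, mutualInteraction]

theorem mutualInteraction_smul_right (hk : Measurable k) (c : ℝ≥0∞)
    (μ ν : Measure (EuclideanSpace ℝ (Fin d))) [SFinite ν] :
    mutualInteraction k μ (c • ν) = c * mutualInteraction k μ ν := by
  simp only [mutualInteraction, lintegral_smul_measure, smul_eq_mul]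
  rw [lintegral_const_mul _ (measurable_potential hk ν)]

theorem mutualInteraction_comm (hk : Measurable k) (heven : ∀ x, k (-x) = k x)
    (μ ν : Measure (EuclideanSpace ℝ (Fin d))) [SFinite μ] [SFinite ν] :
    mutualInteraction k μ ν = mutualInteraction k ν μ := by
  rw [mutualInteraction, lintegral_lintegral_swap (f := fun x y => k (x - y))
    (hk.comp measurable_sub).aemeasurable,
    mutualInteraction]
  refine lintegral_congr fun x => lintegral_congr fun y => ?_
  rw [← heven, neg_sub]

theorem mutualInteraction_map (hk : Measurable k)
    {f : EuclideanSpace ℝ (Fin d) → EuclideanSpace ℝ (Fin d)} (hf : Measurable f)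
    (μ : Measure (EuclideanSpace ℝ (Fin d))) [SFinite μ] :
    mutualInteraction k (μ.map f) (μ.map f) = ∫⁻ x, ∫⁻ y, k (f x - f y) ∂μ ∂μ := by
  rw [mutualInteraction, lintegral_map (measurable_potential hk _) hf]
  refine lintegral_congr fun x => ?_
  exact lintegral_map (f := fun y => k (f x - y)) (hk.comp (measurable_const.sub measurable_id)) hf

end MutualInteraction

/-- The standing assumptions on a minimizer: `σ = ±1` is the sign of the potential `K`, the density
lies in `L^m`, and the interaction energy is finite. -/
structure IsRegularMinimizer (K : EuclideanSpace ℝ (Fin d) → ℝ) (σ m : ℝ)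
    (μ : Measure (EuclideanSpace ℝ (Fin d))) : Prop where
  sign : σ = 1 ∨ σ = -1
  nonneg : ∀ x, 0 ≤ σ * K x
  measurable : Measurable K
  even : ∀ x, K (-x) = K x
  one_lt : 1 < m
  isProbabilityMeasure : IsProbabilityMeasure μ
  absolutelyContinuous : μ ≪ volume
  densityPower_ne_top : densityPower m μ ≠ ∞
  interaction_ne_top : mutualInteraction (fun x => ENNReal.ofReal (σ * K x)) μ μ ≠ ∞
  isMomentMinimizer : IsMomentMinimizer K m μ

namespace IsRegularMinimizer

variable {K : EuclideanSpace ℝ (Fin d) → ℝ} {σ m : ℝ} {μ : Measure (EuclideanSpace ℝ (Fin d))}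

theorem measurable_kernel (h : IsRegularMinimizer K σ m μ) :
    Measurable fun x => ENNReal.ofReal (σ * K x) :=
  (h.measurable.const_mul σ).ennreal_ofReal

theorem energy_le (h : IsRegularMinimizer K σ m μ) {ν : Measure (EuclideanSpace ℝ (Fin d))}
    [IsProbabilityMeasure ν]
    (hmom : ∃ C : ℝ≥0∞, C ≠ ∞ ∧ ∫⁻ x, ‖x‖ₑ ^ 2 ∂ν ≤ C * (∫⁻ x, ‖x‖ₑ ^ 2 ∂μ + 1))
    (hν : ν ≪ volume) (hF : densityPower m ν ≠ ∞)
    (hV : mutualInteraction (fun x => ENNReal.ofReal (σ * K x)) ν ν ≠ ∞) :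
    σ / 2 * (mutualInteraction (fun x => ENNReal.ofReal (σ * K x)) μ μ).toReal +
        (densityPower m μ).toReal / (m - 1) ≤
      σ / 2 * (mutualInteraction (fun x => ENNReal.ofReal (σ * K x)) ν ν).toReal +
        (densityPower m ν).toReal / (m - 1) := by
  have := h.isProbabilityMeasure
  have hle := h.isMomentMinimizer ν inferInstance hmom
  rwa [energy_eq_coe h.sign h.nonneg h.one_lt h.absolutelyContinuous h.densityPower_ne_top
    h.interaction_ne_top, energy_eq_coe h.sign h.nonneg h.one_lt hν hF hV,
    EReal.coe_le_coe_iff] at hle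

/-- The integrated Euler–Lagrange inequality, from reducing the mass on `A`. -/
theorem setLIntegral_potential_le (h : IsRegularMinimizer K σ m μ)
    {A : Set (EuclideanSpace ℝ (Fin d))} (hA : MeasurableSet A) :
    σ * (∫⁻ x in A, ∫⁻ y, ENNReal.ofReal (σ * K (x - y)) ∂μ ∂μ).toReal ≤ (μ A).toReal *
      (σ * (mutualInteraction (fun x => ENNReal.ofReal (σ * K x)) μ μ).toReal +
        m * (densityPower m μ).toReal / (m - 1)) := by
  have := h.isProbabilityMeasure
  have hm1 : 0 < m - 1 := by linarith [h.one_lt]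
  have hk := h.measurable_kernel
  have hcomm := mutualInteraction_comm hk (fun x => by rw [h.even])
    (μ.restrict Aᶜ) (μ.restrict A)
  change σ * (mutualInteraction (fun x => ENNReal.ofReal (σ * K x)) (μ.restrict A) μ).toReal ≤ _
  have hsum : ∀ ν, mutualInteraction (fun x => ENNReal.ofReal (σ * K x)) ν μ =
      mutualInteraction (fun x => ENNReal.ofReal (σ * K x)) ν (μ.restrict A) +
        mutualInteraction (fun x => ENNReal.ofReal (σ * K x)) ν (μ.restrict Aᶜ) := by
    intro ν
    rw [← mutualInteraction_add_right hk, Measure.restrict_add_restrict_compl hA]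
  have hsum' : ∀ ν, mutualInteraction (fun x => ENNReal.ofReal (σ * K x)) μ ν =
      mutualInteraction (fun x => ENNReal.ofReal (σ * K x)) (μ.restrict A) ν +
        mutualInteraction (fun x => ENNReal.ofReal (σ * K x)) (μ.restrict Aᶜ) ν := by
    intro ν
    rw [← mutualInteraction_add_left, Measure.restrict_add_restrict_compl hA]
  have hVtop := h.interaction_ne_top
  have hmin := fun ν hν => @energy_le d K σ m μ h ν hν
  set k := fun x => ENNReal.ofReal (σ * K x) with hkdef
  have hV : mutualInteraction k μ μ = mutualInteraction k (μ.restrict A) (μ.restrict A) +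
      2 * mutualInteraction k (μ.restrict A) (μ.restrict Aᶜ) +
        mutualInteraction k (μ.restrict Aᶜ) (μ.restrict Aᶜ) := by
    rw [hsum' μ, hsum, hsum, hcomm]
    ring
  rw [hsum (μ.restrict A)]
  set a := mutualInteraction k (μ.restrict A) (μ.restrict A) with ha
  set b := mutualInteraction k (μ.restrict A) (μ.restrict Aᶜ) with hb
  set c := mutualInteraction k (μ.restrict Aᶜ) (μ.restrict Aᶜ) with hc
  have htop : a ≠ ∞ ∧ b ≠ ∞ ∧ c ≠ ∞ := by
    rw [hV] at hVtop
    refine ⟨fun h0 => hVtop ?_, fun h0 => hVtop ?_, fun h0 => hVtop ?_⟩ <;> simp [h0]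
  obtain ⟨hat, hbt, hct⟩ := htop
  have hVr : (mutualInteraction k μ μ).toReal = a.toReal + 2 * b.toReal + c.toReal := by
    rw [hV, ENNReal.toReal_add (by finiteness) hct, ENNReal.toReal_add hat (by finiteness),
      ENNReal.toReal_mul, ENNReal.toReal_ofNat]
  rw [ENNReal.toReal_add hat hbt, hVr]
  have hα : (μ A).toReal ≤ 1 := by
    rw [← ENNReal.toReal_one]
    exact ENNReal.toReal_mono ENNReal.one_ne_top prob_le_one
  set α := (μ A).toReal with hαdef
  have hα0 : 0 ≤ α := ENNReal.toReal_nonneg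
  set F := (densityPower m μ).toReal with hF
  have hF0 : 0 ≤ F := ENNReal.toReal_nonneg
  have hineq : ∀ s, 0 < s → s < 1 →
      σ / 2 * (a.toReal + 2 * b.toReal + c.toReal) + F / (m - 1) ≤
        σ / 2 * ((1 - s * α)⁻¹ ^ 2 *
          ((1 - s) ^ 2 * a.toReal + 2 * (1 - s) * b.toReal + c.toReal)) +
          ((1 - s * α)⁻¹ ^ m * F) / (m - 1) := by
    intro s hs0 hs1
    have hsα : 0 < 1 - s * α := by nlinarith
    set t := (1 - s * α)⁻¹ with ht
    have ht0 : 0 < t := inv_pos.2 hsα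
    -- A fraction `s` of the mass on `A` is removed, and `t` renormalises.
    set ν := ENNReal.ofReal t • (ENNReal.ofReal (1 - s) • μ.restrict A + μ.restrict Aᶜ) with hν
    have hνle : ν ≤ ENNReal.ofReal t • μ := by
      intro S
      have hS : (ENNReal.ofReal (1 - s) • μ.restrict A + μ.restrict Aᶜ) S ≤ μ S := by
        conv_rhs => rw [← Measure.restrict_add_restrict_compl (μ := μ) hA]
        simp only [Measure.add_apply, Measure.smul_apply, smul_eq_mul]
        gcongr
        exact mul_le_of_le_one_left zero_le (by rw [ENNReal.ofReal_le_one]; linarith)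
      rw [hν, Measure.smul_apply, Measure.smul_apply, smul_eq_mul, smul_eq_mul]
      gcongr
    have hνp : IsProbabilityMeasure ν := by
      constructor
      have h1 : μ Aᶜ = ENNReal.ofReal (1 - α) := by
        rw [prob_compl_eq_one_sub hA, ENNReal.ofReal_sub _ hα0, ENNReal.ofReal_one, hαdef,
          ENNReal.ofReal_toReal (measure_ne_top _ _)]
      have h2 : μ A = ENNReal.ofReal α := (ENNReal.ofReal_toReal (measure_ne_top _ _)).symm
      simp only [hν, Measure.smul_apply, Measure.add_apply, smul_eq_mul,
        Measure.restrict_apply_univ]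
      rw [h1, h2, ← ENNReal.ofReal_mul (by linarith), ← ENNReal.ofReal_add (by nlinarith)
        (by linarith), ← ENNReal.ofReal_mul ht0.le, ENNReal.ofReal_eq_one,
        show (1 - s) * α + (1 - α) = 1 - s * α by ring, ht, inv_mul_cancel₀ hsα.ne']
    have hνac : ν ≪ volume :=
      (Measure.absolutelyContinuous_of_le_smul hνle).trans h.absolutelyContinuous
    have : IsFiniteMeasure (ENNReal.ofReal (1 - s) • μ.restrict A) :=
      Measure.smul_finite _ ENNReal.ofReal_ne_top
    have hνV : mutualInteraction k ν ν = ENNReal.ofReal t ^ 2 *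
        (ENNReal.ofReal (1 - s) ^ 2 * a + 2 * ENNReal.ofReal (1 - s) * b + c) := by
      rw [hν]
      rw [mutualInteraction_smul_left, mutualInteraction_smul_right hk,
        mutualInteraction_add_left, mutualInteraction_add_right hk,
        mutualInteraction_add_right hk, mutualInteraction_smul_left, mutualInteraction_smul_left,
        mutualInteraction_smul_right hk, mutualInteraction_smul_right hk, hcomm]
      ring
    -- Only `ν ≤ t μ` is used. This discards the decrease of the entropy on `A`, hence the `ρ^(m-1)`
    -- term of the Euler–Lagrange equation; the remaining inequality is all that is needed.
    have hνF : densityPower m ν ≤ ENNReal.ofReal (t ^ m) * densityPower m μ := by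
      rw [← ENNReal.ofReal_rpow_of_pos ht0]
      exact densityPower_le_of_le_smul h.absolutelyContinuous hνle (by linarith)
    have hFt : ENNReal.ofReal (t ^ m) * densityPower m μ ≠ ∞ :=
      ENNReal.mul_ne_top ENNReal.ofReal_ne_top h.densityPower_ne_top
    have hle := hmin ν hνp ⟨ENNReal.ofReal t, ENNReal.ofReal_ne_top, ?_⟩ hνac
      (ne_top_of_le_ne_top hFt hνF) (by rw [hνV]; finiteness)
    · rw [hVr] at hle
      refine hle.trans (add_le_add (le_of_eq ?_) ?_)
      · congr 1
        rw [hνV, ENNReal.toReal_mul, ENNReal.toReal_pow, ENNReal.toReal_ofReal ht0.le,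
          ENNReal.toReal_add (by finiteness) hct, ENNReal.toReal_add (by finiteness)
          (by finiteness), ENNReal.toReal_mul, ENNReal.toReal_mul, ENNReal.toReal_mul,
          ENNReal.toReal_pow, ENNReal.toReal_ofReal (by linarith), ENNReal.toReal_ofNat]
      · gcongr
        refine (ENNReal.toReal_mono hFt hνF).trans ?_
        rw [ENNReal.toReal_mul, ENNReal.toReal_ofReal (by positivity)]
    · calc ∫⁻ x, ‖x‖ₑ ^ 2 ∂ν ≤ ∫⁻ x, ‖x‖ₑ ^ 2 ∂(ENNReal.ofReal t • μ) :=
            lintegral_mono' hνle le_rfl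
        _ = ENNReal.ofReal t * ∫⁻ x, ‖x‖ₑ ^ 2 ∂μ := lintegral_smul_measure _ _
        _ ≤ _ := by gcongr; exact le_self_add
  have hder : HasDerivAt (fun s : ℝ => σ / 2 * ((1 - s * α)⁻¹ ^ 2 *
      ((1 - s) ^ 2 * a.toReal + 2 * (1 - s) * b.toReal + c.toReal)) +
        ((1 - s * α)⁻¹ ^ m * F) / (m - 1))
      (σ / 2 * (2 * α * (a.toReal + 2 * b.toReal + c.toReal) +
        (-2 * a.toReal - 2 * b.toReal)) + (m * α * F) / (m - 1)) 0 := by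
    have h1 : HasDerivAt (fun s : ℝ => 1 - s) (-1) 0 := by
      simpa using (hasDerivAt_id (0 : ℝ)).const_sub 1
    have h2 : HasDerivAt (fun s : ℝ => (1 - s * α)⁻¹) α 0 := by
      have := (((hasDerivAt_id (0 : ℝ)).mul_const α).const_sub 1).inv (by simp)
      exact this.congr_deriv (by simp)
    have h3 := h2.pow 2
    have h4 := h2.rpow_const (p := m) (Or.inl (by simp))
    have h5 := (((h1.pow 2).mul_const a.toReal).add
      ((h1.const_mul 2).mul_const b.toReal)).add_const c.toReal
    have h6 := ((h3.mul h5).const_mul (σ / 2)).add ((h4.mul_const F).div_const (m - 1))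
    refine h6.congr_deriv ?_
    simp
    ring
  have hfin := nonneg_of_hasDerivAt_of_le hder (fun s h0 h1 => by simpa using hineq s h0 h1)
  have : α * (σ * (a.toReal + 2 * b.toReal + c.toReal) + m * F / (m - 1)) -
      σ * (a.toReal + b.toReal) = σ / 2 * (2 * α * (a.toReal + 2 * b.toReal + c.toReal) +
        (-2 * a.toReal - 2 * b.toReal)) + (m * α * F) / (m - 1) := by ring
  linarith

end IsRegularMinimizer

/-! ### Dilations, the virial identity and pointwise Euler–Lagrange bounds -/

theorem mutualInteraction_rieszKernel_map_smul {t : ℝ} (ht : 0 < t) (s : ℝ)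
    (μ : Measure (EuclideanSpace ℝ (Fin d))) [SFinite μ] :
    mutualInteraction (rieszKernel s) (μ.map (t • ·)) (μ.map (t • ·)) =
      ENNReal.ofReal (t ^ s) * mutualInteraction (rieszKernel s) μ μ := by
  have hk := measurable_rieszKernel (d := d) s
  rw [mutualInteraction_map hk (measurable_const_smul t), mutualInteraction,
    ← lintegral_const_mul _ (measurable_potential hk μ)]
  refine lintegral_congr fun x => ?_
  rw [← lintegral_const_mul (f := fun y => rieszKernel s (x - y)) _
    (hk.comp (measurable_const.sub measurable_id))]
  refine lintegral_congr fun y => ?_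
  rw [← smul_sub, rieszKernel_smul ht]

theorem densityPower_map_smul {t : ℝ} (ht : 0 < t) {m : ℝ} (hm : 0 < m)
    (μ : Measure (EuclideanSpace ℝ (Fin d))) [IsFiniteMeasure μ] :
    densityPower m (μ.map (t • ·)) =
      ENNReal.ofReal ((t ^ d)⁻¹ ^ (m - 1)) * densityPower m μ := by
  have hpos : 0 < (t ^ d)⁻¹ := by positivity
  have hmap : (volume : Measure (EuclideanSpace ℝ (Fin d))).map (t • ·) =
      ENNReal.ofReal (t ^ d)⁻¹ • volume := by
    rw [Measure.map_addHaar_smul volume ht.ne', finrank_euclideanSpace, Fintype.card_fin,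
      abs_of_pos hpos]
  rw [densityPower_map (measurableEmbedding_const_smul₀ ht.ne') (by simpa using hpos)
    ENNReal.ofReal_ne_top hmap hm, ENNReal.ofReal_rpow_of_pos hpos]

theorem mutualInteraction_ofReal_eq {K : EuclideanSpace ℝ (Fin d) → ℝ} {σ A B p q : ℝ}
    (hA : 0 ≤ A) (hB : 0 ≤ B) (hK : ∀ x, σ * K x = A * ‖x‖ ^ q + B * ‖x‖ ^ p)
    (μ ν : Measure (EuclideanSpace ℝ (Fin d))) [SFinite ν] :
    mutualInteraction (fun x => ENNReal.ofReal (σ * K x)) μ ν =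
      ENNReal.ofReal A * mutualInteraction (rieszKernel q) μ ν +
        ENNReal.ofReal B * mutualInteraction (rieszKernel p) μ ν := by
  have hq := measurable_rieszKernel (d := d) q
  have hp := measurable_rieszKernel (d := d) p
  have hk : ∀ x, ENNReal.ofReal (σ * K x) =
      ENNReal.ofReal A * rieszKernel q x + ENNReal.ofReal B * rieszKernel p x := by
    intro x
    rw [hK, ENNReal.ofReal_add (by positivity) (by positivity), ENNReal.ofReal_mul hA,
      ENNReal.ofReal_mul hB, rieszKernel, rieszKernel]
  have hq' : ∀ x, Measurable fun y => rieszKernel q (x - y) := fun x =>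
    hq.comp (measurable_const.sub measurable_id)
  have hp' : ∀ x, Measurable fun y => rieszKernel p (x - y) := fun x =>
    hp.comp (measurable_const.sub measurable_id)
  simp only [mutualInteraction, hk]
  rw [← lintegral_const_mul _ (measurable_potential hq ν),
    ← lintegral_const_mul _ (measurable_potential hp ν),
    ← lintegral_add_left ((measurable_potential hq ν).const_mul _)]
  refine lintegral_congr fun x => ?_
  rw [lintegral_add_left ((hq' x).const_mul _), lintegral_const_mul _ (hq' x),
    lintegral_const_mul _ (hp' x)]

namespace IsRegularMinimizer

variable {K : EuclideanSpace ℝ (Fin d) → ℝ} {σ m : ℝ} {μ : Measure (EuclideanSpace ℝ (Fin d))}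

/-- The virial identity, from stationarity under dilations. -/
theorem virial (h : IsRegularMinimizer K σ m μ) {A B p q : ℝ}
    (hA : 0 ≤ A) (hB : 0 ≤ B) (hK : ∀ x, σ * K x = A * ‖x‖ ^ q + B * ‖x‖ ^ p) :
    σ / 2 * (q * (ENNReal.ofReal A * mutualInteraction (rieszKernel q) μ μ).toReal +
      p * (ENNReal.ofReal B * mutualInteraction (rieszKernel p) μ μ).toReal) =
        d * (densityPower m μ).toReal := by
  have := h.isProbabilityMeasure
  have hm1 : 0 < m - 1 := by linarith [h.one_lt]
  have hVtop := h.interaction_ne_top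
  have hmin := fun ν hν => @energy_le d K σ m μ h ν hν
  have hV := mutualInteraction_ofReal_eq hA hB hK μ μ
  set X := ENNReal.ofReal A * mutualInteraction (rieszKernel q) μ μ with hX
  set Y := ENNReal.ofReal B * mutualInteraction (rieszKernel p) μ μ with hY
  have hXt : X ≠ ∞ := by rw [hV] at hVtop; exact fun h0 => hVtop (by simp [h0])
  have hYt : Y ≠ ∞ := by rw [hV] at hVtop; exact fun h0 => hVtop (by simp [h0])
  set F := (densityPower m μ).toReal with hF
  have hineq : ∀ t : ℝ, 0 < t → σ / 2 * (X.toReal + Y.toReal) + F / (m - 1) ≤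
      σ / 2 * (t ^ q * X.toReal + t ^ p * Y.toReal) + ((t ^ d)⁻¹ ^ (m - 1) * F) / (m - 1) := by
    intro t ht
    have hmeas : Measurable fun x : EuclideanSpace ℝ (Fin d) => t • x := measurable_const_smul t
    have hνp : IsProbabilityMeasure (μ.map (t • ·)) :=
      Measure.isProbabilityMeasure_map hmeas.aemeasurable
    have hac : μ.map (t • ·) ≪ volume := by
      refine (h.absolutelyContinuous.map hmeas).trans ?_
      rw [Measure.map_addHaar_smul volume ht.ne']
      exact Measure.smul_absolutelyContinuous
    have hνF := densityPower_map_smul ht (by linarith : 0 < m) μ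
    have hνV : mutualInteraction (fun x => ENNReal.ofReal (σ * K x)) (μ.map (t • ·))
        (μ.map (t • ·)) = ENNReal.ofReal (t ^ q) * X + ENNReal.ofReal (t ^ p) * Y := by
      rw [mutualInteraction_ofReal_eq hA hB hK, mutualInteraction_rieszKernel_map_smul ht,
        mutualInteraction_rieszKernel_map_smul ht]
      ring
    have hle := hmin _ hνp ⟨ENNReal.ofReal t ^ 2, by finiteness, ?_⟩ hac
      (by rw [hνF]; exact ENNReal.mul_ne_top ENNReal.ofReal_ne_top h.densityPower_ne_top)
      (by rw [hνV]; finiteness)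
    · have hmul : ∀ {u : ℝ} (W : ℝ≥0∞), 0 ≤ u → (ENNReal.ofReal u * W).toReal = u * W.toReal :=
        fun W hu => by rw [ENNReal.toReal_mul, ENNReal.toReal_ofReal hu]
      rwa [hνV, hνF, hV, ENNReal.toReal_add hXt hYt, ENNReal.toReal_add (by finiteness)
        (by finiteness), hmul X (by positivity), hmul Y (by positivity),
        hmul (densityPower m μ) (by positivity)] at hle
    · rw [lintegral_map (measurable_enorm.pow_const 2) hmeas]
      simp only [enorm_smul, mul_pow]
      rw [lintegral_const_mul _ (measurable_enorm.pow_const 2), Real.enorm_of_nonneg ht.le]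
      gcongr
      exact le_self_add
  have hder : HasDerivAt (fun t : ℝ => σ / 2 * (t ^ q * X.toReal + t ^ p * Y.toReal) +
      ((t ^ d)⁻¹ ^ (m - 1) * F) / (m - 1))
      (σ / 2 * (q * X.toReal + p * Y.toReal) - d * F) 1 := by
    have h1 : ∀ s : ℝ, HasDerivAt (fun t : ℝ => t ^ s) s 1 := fun s => by
      simpa using Real.hasDerivAt_rpow_const (x := 1) (p := s) (Or.inl one_ne_zero)
    have h2 : HasDerivAt (fun t : ℝ => (t ^ d)⁻¹) (-d) 1 :=
      ((hasDerivAt_pow d (1 : ℝ)).inv (by simp)).congr_deriv (by simp)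
    have h3 := h2.rpow_const (p := m - 1) (Or.inl (by simp))
    refine (((((h1 q).mul_const X.toReal).add ((h1 p).mul_const Y.toReal)).const_mul
      (σ / 2)).add ((h3.mul_const F).div_const (m - 1))).congr_deriv ?_
    simp
    field_simp
    ring
  -- The parameter `t = 1` is interior to the range of dilations, so the derivative vanishes and an
  -- equality results.
  have hloc : IsLocalMin (fun t : ℝ => σ / 2 * (t ^ q * X.toReal + t ^ p * Y.toReal) +
      ((t ^ d)⁻¹ ^ (m - 1) * F) / (m - 1)) 1 := by
    filter_upwards [lt_mem_nhds (zero_lt_one (α := ℝ))] with t ht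
    simpa using hineq t ht
  linarith [hloc.hasDerivAt_eq_zero hder]

theorem setLIntegral_potential_ne_top (h : IsRegularMinimizer K σ m μ)
    (A : Set (EuclideanSpace ℝ (Fin d))) :
    ∫⁻ x in A, ∫⁻ y, ENNReal.ofReal (σ * K (x - y)) ∂μ ∂μ ≠ ∞ :=
  ne_top_of_le_ne_top h.interaction_ne_top (setLIntegral_le_lintegral _ _)

theorem ae_potential_le (h : IsRegularMinimizer K 1 m μ) : ∀ᵐ x ∂μ,
    ∫⁻ y, ENNReal.ofReal (1 * K (x - y)) ∂μ ≤ ENNReal.ofReal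
      ((mutualInteraction (fun x => ENNReal.ofReal (1 * K x)) μ μ).toReal +
        m * (densityPower m μ).toReal / (m - 1)) := by
  have := h.isProbabilityMeasure
  refine ae_le_of_forall_setLIntegral_le_of_sigmaFinite
    (measurable_potential h.measurable_kernel μ) fun A hA _ => ?_
  have hEL := h.setLIntegral_potential_le hA
  rw [one_mul, one_mul] at hEL
  rw [setLIntegral_const, ← ENNReal.ofReal_toReal (h.setLIntegral_potential_ne_top A),
    ← ENNReal.ofReal_toReal (measure_ne_top μ A), ← ENNReal.ofReal_mul' ENNReal.toReal_nonneg,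
    mul_comm]
  exact ENNReal.ofReal_le_ofReal hEL

/-- For `σ = -1` the integrated inequality reverses: the potential of `|K|` has a lower bound. It is
informative only when the multiplier is positive. -/
theorem ae_le_potential (h : IsRegularMinimizer K (-1) m μ) : ∀ᵐ x ∂μ, ENNReal.ofReal
      ((mutualInteraction (fun x => ENNReal.ofReal (-1 * K x)) μ μ).toReal -
        m * (densityPower m μ).toReal / (m - 1)) ≤
      ∫⁻ y, ENNReal.ofReal (-1 * K (x - y)) ∂μ := by
  have := h.isProbabilityMeasure
  refine ae_le_of_forall_setLIntegral_le_of_sigmaFinite measurable_const fun A hA _ => ?_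
  have hEL := h.setLIntegral_potential_le hA
  rw [setLIntegral_const, ← ENNReal.ofReal_toReal (h.setLIntegral_potential_ne_top A),
    ← ENNReal.ofReal_toReal (measure_ne_top μ A), ← ENNReal.ofReal_mul' ENNReal.toReal_nonneg]
  refine ENNReal.ofReal_le_ofReal ?_
  linarith

end IsRegularMinimizer

/-! ### Closing gaps in the support -/

/-- Moves the half-space `{x | c ≤ x i}` by `-b` in the direction of the `i`-th axis. -/
noncomputable def closeGap (i : Fin d) (c b : ℝ) (x : EuclideanSpace ℝ (Fin d)) :
    EuclideanSpace ℝ (Fin d) :=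
  open Classical in if x i < c then x else x - EuclideanSpace.single i b

theorem measurable_coord (i : Fin d) : Measurable fun x : EuclideanSpace ℝ (Fin d) => x i :=
  (EuclideanSpace.proj (𝕜 := ℝ) i).continuous.measurable

theorem measurableSet_coord_lt (i : Fin d) (c : ℝ) :
    MeasurableSet {x : EuclideanSpace ℝ (Fin d) | x i < c} :=
  measurableSet_lt (measurable_coord i) measurable_const

theorem measurable_closeGap (i : Fin d) (c b : ℝ) : Measurable (closeGap i c b) :=
  Measurable.ite (measurableSet_coord_lt i c) measurable_id (measurable_id.sub_const _)

/-- The `i`-th coordinate stays at most `-b`, and the squared norm changes by `2 b z i + b² ≤ -3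
b²`. Closing only half of a gap of width `2b` keeps differences off the origin, where the kernel is
not monotone. -/
theorem norm_add_single_lt {i : Fin d} {b : ℝ} (hb : 0 < b) {z : EuclideanSpace ℝ (Fin d)}
    (hz : z i ≤ -(2 * b)) :
    z + EuclideanSpace.single i b ≠ 0 ∧ ‖z + EuclideanSpace.single i b‖ < ‖z‖ := by
  constructor
  · intro h0
    have := congrArg (fun v : EuclideanSpace ℝ (Fin d) => v i) h0
    simp at this
    linarith
  · refine lt_of_pow_lt_pow_left₀ 2 (norm_nonneg _) ?_
    rw [norm_add_sq_real, EuclideanSpace.inner_single_right, PiLp.norm_single,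
      Real.norm_of_nonneg hb.le]
    simp
    nlinarith

theorem closeGap_sub_closeGap_of_lt {i : Fin d} {c b : ℝ} (hb : 0 < b)
    {x y : EuclideanSpace ℝ (Fin d)} (hx : x i < c) (hy : c + 2 * b ≤ y i) :
    closeGap i c b x - closeGap i c b y ≠ 0 ∧
      ‖closeGap i c b x - closeGap i c b y‖ < ‖x - y‖ := by
  have hy' : ¬ y i < c := by linarith
  rw [closeGap, closeGap, if_pos hx, if_neg hy', ← sub_add]
  exact norm_add_single_lt hb (by simp; linarith)

theorem closeGap_sub_closeGap {i : Fin d} {c b : ℝ} (hb : 0 < b) {x y : EuclideanSpace ℝ (Fin d)}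
    (hx : x i < c ∨ c + 2 * b ≤ x i) (hy : y i < c ∨ c + 2 * b ≤ y i) :
    closeGap i c b x - closeGap i c b y = x - y ∨
      (closeGap i c b x - closeGap i c b y ≠ 0 ∧
        ‖closeGap i c b x - closeGap i c b y‖ < ‖x - y‖) := by
  rcases hx with hx | hx <;> rcases hy with hy | hy
  · simp [closeGap, hx, hy]
  · exact Or.inr (closeGap_sub_closeGap_of_lt hb hx hy)
  · right
    rw [← neg_ne_zero, ← norm_neg, ← norm_neg (x - y), neg_sub, neg_sub]
    exact closeGap_sub_closeGap_of_lt hb hy hx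
  · left
    have hx' : ¬ x i < c := by linarith
    have hy' : ¬ y i < c := by linarith
    simp [closeGap, hx', hy']

section CloseGap

variable {μ : Measure (EuclideanSpace ℝ (Fin d))} {i : Fin d} {c b : ℝ}

/-- Since the slab is null and only half of it is closed, the two images remain on opposite sides of
the hyperplane. The pushforward is thus a piece of `μ` plus a translated piece, with no overlap, so
the entropy is preserved. -/
theorem restrict_map_closeGap (hb : 0 < b) (hgap : μ {x | c ≤ x i ∧ x i < c + 2 * b} = 0) :
    (μ.map (closeGap i c b)).restrict {x | x i < c} = μ.restrict {x | x i < c} ∧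
      (μ.map (closeGap i c b)).restrict {x | x i < c}ᶜ =
        (μ.restrict {x | x i < c}ᶜ).map (· - EuclideanSpace.single i b) := by
  have hS := measurableSet_coord_lt i c
  have hf := measurable_closeGap i c b
  have hpre : closeGap i c b ⁻¹' {x | x i < c} =ᵐ[μ] {x | x i < c} := by
    have : ∀ᵐ x ∂μ, ¬ (c ≤ x i ∧ x i < c + 2 * b) :=
      measure_eq_zero_iff_ae_notMem.1 hgap
    filter_upwards [this] with x hx
    refine propext ?_
    change closeGap i c b x i < c ↔ x i < c
    rw [closeGap]
    split_ifs with h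
    · exact Iff.rfl
    · have : c + 2 * b ≤ x i := by
        by_contra hcon
        exact hx ⟨not_lt.1 h, not_le.1 hcon⟩
      simp only [PiLp.sub_apply, PiLp.single_apply, if_true]
      constructor <;> intro <;> linarith
  constructor
  · rw [Measure.restrict_map hf hS, Measure.restrict_congr_set hpre]
    conv_rhs => rw [← Measure.map_id (μ := μ.restrict {x | x i < c})]
    refine Measure.map_congr ?_
    filter_upwards [ae_restrict_mem hS] with x hx
    exact if_pos hx
  · rw [Measure.restrict_map hf hS.compl, Set.preimage_compl, Measure.restrict_congr_set hpre.compl]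
    refine Measure.map_congr ?_
    filter_upwards [ae_restrict_mem hS.compl] with x hx
    exact if_neg hx

theorem map_sub_const_volume (v : EuclideanSpace ℝ (Fin d)) :
    (volume : Measure (EuclideanSpace ℝ (Fin d))).map (· - v) = volume :=
  (measurePreserving_sub_right volume v).map_eq

theorem map_closeGap_absolutelyContinuous (hμ : μ ≪ volume) (hb : 0 < b)
    (hgap : μ {x | c ≤ x i ∧ x i < c + 2 * b} = 0) : μ.map (closeGap i c b) ≪ volume := by
  obtain ⟨h1, h2⟩ := restrict_map_closeGap hb hgap
  rw [← Measure.restrict_add_restrict_compl (μ := μ.map (closeGap i c b))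
    (measurableSet_coord_lt i c), h1, h2]
  refine Measure.AbsolutelyContinuous.add_left (Measure.restrict_le_self.absolutelyContinuous.trans
    hμ) ?_
  rw [← map_sub_const_volume (EuclideanSpace.single i b)]
  exact (Measure.restrict_le_self.absolutelyContinuous.trans hμ).map (measurable_id.sub_const _)

theorem densityPower_map_closeGap [IsFiniteMeasure μ] (hb : 0 < b)
    (hgap : μ {x | c ≤ x i ∧ x i < c + 2 * b} = 0) {m : ℝ} (hm : 0 < m) :
    densityPower m (μ.map (closeGap i c b)) = densityPower m μ := by
  obtain ⟨h1, h2⟩ := restrict_map_closeGap hb hgap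
  rw [densityPower_eq_restrict_add (measurableSet_coord_lt i c) hm, h1, h2,
    densityPower_map (measurableEmbedding_subRight _) one_ne_zero ENNReal.one_ne_top
      (by rw [one_smul]; exact map_sub_const_volume _) hm, ENNReal.one_rpow, one_mul,
    ← densityPower_eq_restrict_add (measurableSet_coord_lt i c) hm]

theorem lintegral_enorm_sq_map_closeGap_le [IsProbabilityMeasure μ] :
    ∃ C : ℝ≥0∞, C ≠ ∞ ∧ ∫⁻ x, ‖x‖ₑ ^ 2 ∂(μ.map (closeGap i c b)) ≤
      C * (∫⁻ x, ‖x‖ₑ ^ 2 ∂μ + 1) := by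
  set v : EuclideanSpace ℝ (Fin d) := EuclideanSpace.single i b with hv
  refine ⟨2 * (1 + ‖v‖ₑ ^ 2), by finiteness, ?_⟩
  rw [lintegral_map (measurable_enorm.pow_const 2) (measurable_closeGap i c b)]
  have hpt : ∀ x, ‖closeGap i c b x‖ₑ ^ 2 ≤ 2 * (‖x‖ₑ ^ 2 + ‖v‖ₑ ^ 2) := by
    intro x
    have h1 : ‖closeGap i c b x‖ₑ ≤ ‖x‖ₑ + ‖v‖ₑ := by
      rw [closeGap]
      split_ifs
      · exact le_self_add
      · exact enorm_sub_le
    calc ‖closeGap i c b x‖ₑ ^ 2 ≤ (‖x‖ₑ + ‖v‖ₑ) ^ 2 := by gcongr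
      _ ≤ 2 * (‖x‖ₑ ^ 2 + ‖v‖ₑ ^ 2) := by
          have := ENNReal.rpow_add_le_mul_rpow_add_rpow ‖x‖ₑ ‖v‖ₑ one_le_two
          norm_num at this
          exact this
  refine (lintegral_mono hpt).trans ?_
  rw [lintegral_const_mul _ ((measurable_enorm.pow_const 2).add_const _),
    lintegral_add_right _ measurable_const, lintegral_const, measure_univ, mul_one, mul_assoc]
  gcongr
  rw [add_mul, one_mul, mul_add, mul_one]
  exact add_le_add le_self_add le_add_self

end CloseGap

/-- The support of a minimizer for an attractive potential has no gaps in any coordinate. -/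
theorem IsRegularMinimizer.measure_lt_eq_zero_or {K : EuclideanSpace ℝ (Fin d) → ℝ} {m : ℝ}
    {μ : Measure (EuclideanSpace ℝ (Fin d))} (h : IsRegularMinimizer K (-1) m μ)
    (hanti : ∀ x y, x ≠ 0 → ‖x‖ < ‖y‖ → -1 * K y < -1 * K x)
    (hfin : ∀ ν : Measure (EuclideanSpace ℝ (Fin d)), IsProbabilityMeasure ν → ν ≪ volume →
      densityPower m ν ≠ ∞ → mutualInteraction (fun x => ENNReal.ofReal (-1 * K x)) ν ν ≠ ∞)
    {i : Fin d} {c b : ℝ} (hb : 0 < b) (hgap : μ {x | c ≤ x i ∧ x i < c + 2 * b} = 0) :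
    μ {x | x i < c} = 0 ∨ μ {x | c + 2 * b ≤ x i} = 0 := by
  have := h.isProbabilityMeasure
  have hm : 0 < m := by linarith [h.one_lt]
  have hf := measurable_closeGap i c b
  have hk := h.measurable_kernel
  have hνp : IsProbabilityMeasure (μ.map (closeGap i c b)) :=
    Measure.isProbabilityMeasure_map hf.aemeasurable
  have hac := map_closeGap_absolutelyContinuous h.absolutelyContinuous hb hgap
  have hF := densityPower_map_closeGap hb hgap hm
  have hνV := hfin _ hνp hac (hF ▸ h.densityPower_ne_top)
  have hle := h.energy_le lintegral_enorm_sq_map_closeGap_le hac (hF ▸ h.densityPower_ne_top) hνV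
  -- The entropies agree and the interaction enters with a negative sign, so minimality forbids an
  -- increase of `V`.
  have hVle : mutualInteraction (fun x => ENNReal.ofReal (-1 * K x)) (μ.map (closeGap i c b))
      (μ.map (closeGap i c b)) ≤ mutualInteraction (fun x => ENNReal.ofReal (-1 * K x)) μ μ := by
    rw [← ENNReal.toReal_le_toReal hνV h.interaction_ne_top]
    rw [hF] at hle
    linarith
  have hVtop := h.interaction_ne_top
  rw [mutualInteraction_map hk hf] at hVle
  rw [mutualInteraction] at hVle hVtop
  have hm1 : Measurable fun z : EuclideanSpace ℝ (Fin d) × EuclideanSpace ℝ (Fin d) =>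
      ENNReal.ofReal (-1 * K (z.1 - z.2)) := hk.comp measurable_sub
  have hm2 : Measurable fun z : EuclideanSpace ℝ (Fin d) × EuclideanSpace ℝ (Fin d) =>
      ENNReal.ofReal (-1 * K (closeGap i c b z.1 - closeGap i c b z.2)) :=
    hk.comp ((hf.comp measurable_fst).sub (hf.comp measurable_snd))
  rw [← lintegral_prod _ hm1.aemeasurable] at hVle hVtop
  rw [← lintegral_prod _ hm2.aemeasurable] at hVle
  have hside : ∀ᵐ x ∂μ, x i < c ∨ c + 2 * b ≤ x i := by
    have : ∀ᵐ x ∂μ, ¬ (c ≤ x i ∧ x i < c + 2 * b) :=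
      measure_eq_zero_iff_ae_notMem.1 hgap
    filter_upwards [this] with x hx
    by_contra! hcon
    exact hx hcon
  have hlt : ∀ x y, x ≠ 0 → ‖x‖ < ‖y‖ →
      ENNReal.ofReal (-1 * K y) < ENNReal.ofReal (-1 * K x) := fun x y hx hxy =>
    (ENNReal.ofReal_lt_ofReal_iff_of_nonneg (h.nonneg y)).2 (hanti x y hx hxy)
  have hpt : ∀ᵐ z ∂(μ.prod μ), ENNReal.ofReal (-1 * K (z.1 - z.2)) ≤
      ENNReal.ofReal (-1 * K (closeGap i c b z.1 - closeGap i c b z.2)) := by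
    filter_upwards [Measure.quasiMeasurePreserving_fst.ae hside,
      Measure.quasiMeasurePreserving_snd.ae hside] with z h1 h2
    rcases closeGap_sub_closeGap hb h1 h2 with h3 | h3
    · rw [h3]
    · exact (hlt _ _ h3.1 h3.2).le
  -- Pointwise increase without increase of the finite integral forces almost everywhere equality,
  -- whereas the increase is strict for pairs on opposite sides of the gap.
  have heq := ae_eq_of_ae_le_of_lintegral_le hpt hVtop hm2.aemeasurable hVle
  have hnull : (μ.prod μ) ({x | x i < c} ×ˢ {x | c + 2 * b ≤ x i}) = 0 := by
    refine measure_mono_null ?_ heq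
    rintro z ⟨h1, h2⟩ h3
    have h4 := closeGap_sub_closeGap_of_lt hb h1 h2
    exact (hlt _ _ h4.1 h4.2).ne h3
  rwa [Measure.prod_prod, mul_eq_zero] at hnull

/-! ### Measures with gapless coordinate projections -/

/-- If balls around almost every point have mass at least `δ` and the distribution of a coordinate
has no gaps of length `r`, then that coordinate is essentially bounded. -/
theorem exists_ae_abs_coord_sub_le {μ : Measure (EuclideanSpace ℝ (Fin d))}
    [IsProbabilityMeasure μ] {r δ : ℝ} (hr : 0 < r) (hδ : 0 < δ)
    (hball : ∀ᵐ x ∂μ, ENNReal.ofReal δ ≤ μ (Metric.ball x r)) {i : Fin d}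
    (hgap : ∀ c, μ {x | c ≤ x i ∧ x i < c + r} = 0 → μ {x | x i < c} = 0 ∨
      μ {x | c + r ≤ x i} = 0) :
    ∃ a : ℝ, ∀ᵐ x ∂μ, |x i - a| ≤ (3 / δ + 1) * r := by
  classical
  -- The coordinate is binned into cells of length `r`, so that `ν {k}` is the mass of the cell `[k
  -- r, (k + 1) r)`.
  set f : EuclideanSpace ℝ (Fin d) → ℤ := fun x => ⌊x i / r⌋ with hf
  have hfm : Measurable f := Int.measurable_floor.comp ((measurable_coord i).div_const r)
  set ν := μ.map f with hν
  have hνp : IsProbabilityMeasure ν := Measure.isProbabilityMeasure_map hfm.aemeasurable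
  have hνs : ∀ s : Set ℤ, ν s = μ (f ⁻¹' s) := fun s => Measure.map_apply hfm (by measurability)
  have hfl : ∀ (x : EuclideanSpace ℝ (Fin d)) (k : ℤ), f x = k ↔
      k * r ≤ x i ∧ x i < k * r + r := by
    intro x k
    rw [hf, Int.floor_eq_iff, le_div_iff₀ hr, div_lt_iff₀ hr, add_mul, one_mul]
  have hmass : ∀ k : ℤ, ν {k} ≠ 0 → ENNReal.ofReal δ ≤ ν {k - 1} + ν {k} + ν {k + 1} := by
    intro k hk
    rw [hνs] at hk
    obtain ⟨x, hx, hxk⟩ := (frequently_ae_iff.2 hk).and_eventually hball |>.exists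
    refine hxk.trans ?_
    have hsub : Metric.ball x r ⊆ f ⁻¹' {k - 1} ∪ f ⁻¹' {k} ∪ f ⁻¹' {k + 1} := by
      intro y hy
      have h1 : |y i - x i| < r := by
        calc |y i - x i| = ‖(y - x) i‖ := rfl
          _ ≤ ‖y - x‖ := PiLp.norm_apply_le _ _
          _ < r := by rwa [← dist_eq_norm]
      obtain ⟨h2, h3⟩ := abs_lt.1 h1
      obtain ⟨h4, h5⟩ := (hfl x k).1 hx
      simp only [Set.mem_union, Set.mem_preimage, Set.mem_singleton_iff, hfl]
      push_cast
      by_cases h6 : y i < k * r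
      · exact Or.inl (Or.inl ⟨by linarith, by linarith⟩)
      · by_cases h7 : y i < k * r + r
        · exact Or.inl (Or.inr ⟨by linarith, by linarith⟩)
        · exact Or.inr ⟨by linarith, by linarith⟩
    rw [hνs, hνs, hνs]
    exact (measure_mono hsub).trans ((measure_union_le _ _).trans
      (add_le_add_left (measure_union_le _ _) _))
  -- A ball around a point of cell `k` meets only the cells `k - 1`, `k`, `k + 1`; summing over `T`
  -- counts each cell at most three times.
  have hcard : ∀ T : Finset ℤ, (∀ k ∈ T, ν {k} ≠ 0) → T.card * δ ≤ 3 := by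
    intro T hT
    have hshift : ∀ e : ℤ, ∑ k ∈ T, ν {k + e} ≤ 1 := by
      intro e
      rw [← Finset.sum_image (f := fun k => ν {k}) (g := fun k => k + e)
        (fun _ _ _ _ hxy => by simpa using hxy), sum_measure_singleton]
      exact prob_le_one
    have h1 : ∑ _k ∈ T, ENNReal.ofReal δ ≤ 3 := by
      calc ∑ _k ∈ T, ENNReal.ofReal δ ≤ ∑ k ∈ T, (ν {k + -1} + ν {k + 0} + ν {k + 1}) := by
            refine Finset.sum_le_sum fun k hk => ?_
            simpa [sub_eq_add_neg] using hmass k (hT k hk)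
        _ ≤ 1 + 1 + 1 := by
            rw [Finset.sum_add_distrib, Finset.sum_add_distrib]
            exact add_le_add (add_le_add (hshift _) (hshift _)) (hshift _)
        _ = 3 := by norm_num
    rw [Finset.sum_const, nsmul_eq_mul, ← ENNReal.ofReal_natCast,
      ← ENNReal.ofReal_mul (by positivity), ENNReal.ofReal_le_ofNat] at h1
    exact h1
  -- The charged cells form an interval: an uncharged one is a gap of length `r`, hence has no mass
  -- on one side.
  have hconv : ∀ j k l : ℤ, j ≤ k → k ≤ l → ν {j} ≠ 0 → ν {l} ≠ 0 → ν {k} ≠ 0 := by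
    intro j k l hjk hkl hj hl hk
    have hj' : j < k := lt_of_le_of_ne hjk (by rintro rfl; exact hj hk)
    have hl' : k < l := lt_of_le_of_ne hkl (by rintro rfl; exact hl hk)
    have hzero : μ {x | k * r ≤ x i ∧ x i < k * r + r} = 0 := by
      rw [hνs] at hk
      exact measure_mono_null (fun x hx => (hfl x k).2 hx) hk
    rcases hgap _ hzero with h1 | h1
    · refine hj ?_
      rw [hνs]
      refine measure_mono_null (fun x hx => ?_) h1
      have h2 := ((hfl x j).1 hx).2
      have h3 : ((j : ℝ) + 1) * r ≤ k * r := by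
        gcongr
        exact_mod_cast hj'
      change x i < k * r
      linarith
    · refine hl ?_
      rw [hνs]
      refine measure_mono_null (fun x hx => ?_) h1
      have h2 := ((hfl x l).1 hx).1
      have h3 : ((k : ℝ) + 1) * r ≤ l * r := by
        gcongr
        exact_mod_cast hl'
      change k * r + r ≤ x i
      linarith
  have hae : ∀ᵐ x ∂μ, ν {f x} ≠ 0 := by
    have h1 : ν {k | ν {k} = 0} = 0 := by
      rw [← Set.biUnion_of_singleton {k | ν {k} = 0}]
      exact (measure_biUnion_null_iff (Set.to_countable _)).2 fun k hk => hk
    rw [hνs] at h1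
    exact measure_eq_zero_iff_ae_notMem.1 h1
  obtain ⟨x₀, hx₀⟩ := hae.exists
  have hdist : ∀ k l : ℤ, k ≤ l → ν {k} ≠ 0 → ν {l} ≠ 0 → (l : ℝ) - k ≤ 3 / δ := by
    intro k l hkl hk hl
    have h1 := hcard (Finset.Icc k l) fun j hj =>
      hconv k j l (Finset.mem_Icc.1 hj).1 (Finset.mem_Icc.1 hj).2 hk hl
    rw [le_div_iff₀ hδ]
    refine le_trans ?_ h1
    gcongr
    rw [Int.card_Icc]
    have h2 : (l - k : ℤ) ≤ ((l + 1 - k).toNat : ℤ) := by omega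
    exact_mod_cast h2
  refine ⟨f x₀ * r, ?_⟩
  filter_upwards [hae] with x hx
  obtain ⟨h1, h2⟩ := (hfl x (f x)).1 rfl
  have h3 : |(f x : ℝ) - f x₀| ≤ 3 / δ := by
    rcases le_total (f x₀) (f x) with hle | hle
    · rw [abs_of_nonneg (sub_nonneg.2 (Int.cast_le.2 hle))]
      exact hdist _ _ hle hx₀ hx
    · rw [abs_sub_comm, abs_of_nonneg (sub_nonneg.2 (Int.cast_le.2 hle))]
      exact hdist _ _ hle hx hx₀
  obtain ⟨h4, h5⟩ := abs_le.1 h3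
  rw [abs_le]
  constructor <;> nlinarith

/-! ### Supports and Riesz energy estimates -/

theorem support_map_sub_subset_ball {μ : Measure (EuclideanSpace ℝ (Fin d))}
    {a : EuclideanSpace ℝ (Fin d)} {R : ℝ} (h : ∀ᵐ x ∂μ, ‖x - a‖ ≤ R) :
    (μ.map (fun x => x - a)).support ⊆ Metric.ball 0 (R + 1) := by
  refine (Measure.support_subset_of_isClosed (Metric.isClosed_closedBall (x := 0) (ε := R))
    ?_).trans (Metric.closedBall_subset_ball (by linarith))
  have hmeas : AEMeasurable (fun x => x - a) μ := (measurable_id.sub_const a).aemeasurable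
  rw [mem_ae_map_iff hmeas Metric.isClosed_closedBall.measurableSet]
  filter_upwards [h] with x hx
  simpa using hx

/-- The exponent `p m / (m - 1)` tends to `p` as `m → ∞`, so it eventually exceeds any fixed `s <
p`; `s / (s - p)` is the threshold. -/
theorem le_mul_div_sub_one {p s m : ℝ} (hsp : s < p) (hm : 1 < m) (h : s / (s - p) ≤ m) :
    s ≤ p * (m / (m - 1)) := by
  rw [div_le_iff_of_neg (by linarith)] at h
  rw [← mul_div_assoc, le_div_iff₀ (by linarith)]
  linarith

theorem mutualInteraction_rieszKernel_le {p s m : ℝ} (hp : p < 0) (hm : 1 < m)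
    (hs : s ≤ p * (m / (m - 1))) {μ : Measure (EuclideanSpace ℝ (Fin d))}
    [IsProbabilityMeasure μ] (hμ : μ ≪ volume) :
    mutualInteraction (rieszKernel p) μ μ ≤
      (∫⁻ y in Metric.ball (0 : EuclideanSpace ℝ (Fin d)) 1, rieszKernel s y) +
        densityPower m μ / ENNReal.ofReal m + 2 := by
  have hpt : ∀ x, ∫⁻ y, rieszKernel p (x - y) ∂μ ≤
      (∫⁻ y in Metric.ball (0 : EuclideanSpace ℝ (Fin d)) 1, rieszKernel s y) +
        densityPower m μ / ENNReal.ofReal m + 2 := by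
    intro x
    refine (lintegral_rieszKernel_sub_le hp hm hs one_pos le_rfl one_pos hμ x).trans ?_
    rw [Real.one_rpow, ENNReal.ofReal_one, one_mul, add_assoc]
    refine add_le_add_right ?_ _
    calc μ (Metric.ball x 1) + 1 ≤ 1 + 1 := by gcongr; exact prob_le_one
      _ = 2 := one_add_one_eq_two
  calc mutualInteraction (rieszKernel p) μ μ ≤ ∫⁻ _x, _ ∂μ := lintegral_mono hpt
    _ = _ := by rw [lintegral_const, measure_univ, mul_one]

theorem lintegral_enorm_sq_le_of_ae_norm_le {μ ν : Measure (EuclideanSpace ℝ (Fin d))}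
    [IsProbabilityMeasure ν] {r : ℝ} (h : ∀ᵐ x ∂ν, ‖x‖ ≤ r) :
    ∃ C : ℝ≥0∞, C ≠ ∞ ∧ ∫⁻ x, ‖x‖ₑ ^ 2 ∂ν ≤ C * (∫⁻ x, ‖x‖ₑ ^ 2 ∂μ + 1) := by
  refine ⟨ENNReal.ofReal r ^ 2, by finiteness, ?_⟩
  calc ∫⁻ x, ‖x‖ₑ ^ 2 ∂ν ≤ ∫⁻ _x, ENNReal.ofReal r ^ 2 ∂ν := by
        refine lintegral_mono_ae ?_
        filter_upwards [h] with x hx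
        rw [← ofReal_norm]
        gcongr
    _ = ENNReal.ofReal r ^ 2 * 1 := by rw [lintegral_const, measure_univ]
    _ ≤ _ := by gcongr; exact le_add_self

theorem mutualInteraction_rieszKernel_le_of_ae_norm_le {q r : ℝ} (hq : 0 ≤ q)
    {ν : Measure (EuclideanSpace ℝ (Fin d))} [IsProbabilityMeasure ν] (h : ∀ᵐ x ∂ν, ‖x‖ ≤ r) :
    mutualInteraction (rieszKernel q) ν ν ≤ ENNReal.ofReal ((2 * r) ^ q) := by
  calc mutualInteraction (rieszKernel q) ν ν
      ≤ ∫⁻ _x, ∫⁻ _y, ENNReal.ofReal ((2 * r) ^ q) ∂ν ∂ν := by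
        refine lintegral_mono_ae ?_
        filter_upwards [h] with x hx
        refine lintegral_mono_ae ?_
        filter_upwards [h] with y hy
        refine ENNReal.ofReal_le_ofReal (Real.rpow_le_rpow (norm_nonneg _) ?_ hq)
        linarith [norm_sub_le x y]
    _ = _ := by simp

theorem le_mutualInteraction_rieszKernel_of_ae_norm_le [NeZero d] {p r : ℝ} (hp : p < 0)
    {ν : Measure (EuclideanSpace ℝ (Fin d))} [IsProbabilityMeasure ν] (hν : ν ≪ volume)
    (h : ∀ᵐ x ∂ν, ‖x‖ ≤ r) :
    ENNReal.ofReal ((2 * r) ^ p) ≤ mutualInteraction (rieszKernel p) ν ν := by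
  calc ENNReal.ofReal ((2 * r) ^ p) = ∫⁻ _x, ∫⁻ _y, ENNReal.ofReal ((2 * r) ^ p) ∂ν ∂ν := by simp
    _ ≤ _ := by
        refine lintegral_mono_ae ?_
        filter_upwards [h] with x hx
        refine lintegral_mono_ae ?_
        -- The diagonal must be excluded because `0 ^ p = 0` there; it is null since `ν` has a
        -- density.
        have hne : ∀ᵐ y ∂ν, y ∉ ({x} : Set (EuclideanSpace ℝ (Fin d))) :=
          measure_eq_zero_iff_ae_notMem.1 (hν (measure_singleton x))
        filter_upwards [h, hne] with y hy hxy
        have hpos : 0 < ‖x - y‖ := norm_pos_iff.2 (sub_ne_zero.2 fun h0 => hxy h0.symm)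
        refine ENNReal.ofReal_le_ofReal (Real.rpow_le_rpow_of_nonpos hpos ?_ hp.le)
        linarith [norm_sub_le x y]

theorem rieszKernel_sub_le {q : ℝ} (hq : 0 ≤ q) (x a y : EuclideanSpace ℝ (Fin d)) :
    rieszKernel q (x - a) ≤
      ENNReal.ofReal (2 ^ q) * (rieszKernel q (x - y) + rieszKernel q (a - y)) := by
  rw [rieszKernel, rieszKernel, rieszKernel, ← ENNReal.ofReal_add (by positivity) (by positivity),
    ← ENNReal.ofReal_mul (by positivity)]
  refine ENNReal.ofReal_le_ofReal ?_
  have htri : ‖x - a‖ ≤ ‖x - y‖ + ‖a - y‖ := by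
    rw [norm_sub_rev a y]; exact norm_sub_le_norm_sub_add_norm_sub x y a
  have h1 : (0 : ℝ) ≤ ‖x - y‖ ^ q := by positivity
  have h2 : (0 : ℝ) ≤ ‖a - y‖ ^ q := by positivity
  rcases le_total ‖x - y‖ ‖a - y‖ with hle | hle
  · calc ‖x - a‖ ^ q ≤ (2 * ‖a - y‖) ^ q := by gcongr; linarith
      _ = 2 ^ q * ‖a - y‖ ^ q := Real.mul_rpow (by norm_num) (norm_nonneg _)
      _ ≤ _ := by gcongr; linarith
  · calc ‖x - a‖ ^ q ≤ (2 * ‖x - y‖) ^ q := by gcongr; linarith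
      _ = 2 ^ q * ‖x - y‖ ^ q := Real.mul_rpow (by norm_num) (norm_nonneg _)
      _ ≤ _ := by gcongr; linarith

/-- Points with bounded potential of positive exponent are close to each other. -/
theorem norm_sub_le_of_lintegral_rieszKernel_le {q C : ℝ} (hq : 0 < q) (hC : 0 ≤ C)
    {μ : Measure (EuclideanSpace ℝ (Fin d))} [IsProbabilityMeasure μ]
    {x a : EuclideanSpace ℝ (Fin d)}
    (hx : ∫⁻ y, rieszKernel q (x - y) ∂μ ≤ ENNReal.ofReal C)
    (ha : ∫⁻ y, rieszKernel q (a - y) ∂μ ≤ ENNReal.ofReal C) :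
    ‖x - a‖ ≤ (2 ^ q * (C + C)) ^ q⁻¹ := by
  have hmeas : ∀ z : EuclideanSpace ℝ (Fin d), Measurable fun y => rieszKernel q (z - y) :=
    fun z => (measurable_rieszKernel q).comp (measurable_const.sub measurable_id)
  have h1 : rieszKernel q (x - a) ≤ ENNReal.ofReal (2 ^ q * (C + C)) := by
    calc rieszKernel q (x - a) = ∫⁻ _y, rieszKernel q (x - a) ∂μ := by simp
      _ ≤ ∫⁻ y, ENNReal.ofReal (2 ^ q) * (rieszKernel q (x - y) + rieszKernel q (a - y)) ∂μ :=
          lintegral_mono (rieszKernel_sub_le hq.le x a)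
      _ = ENNReal.ofReal (2 ^ q) *
          (∫⁻ y, rieszKernel q (x - y) ∂μ + ∫⁻ y, rieszKernel q (a - y) ∂μ) := by
          rw [lintegral_const_mul' _ _ ENNReal.ofReal_ne_top, lintegral_add_left (hmeas x)]
      _ ≤ ENNReal.ofReal (2 ^ q) * (ENNReal.ofReal C + ENNReal.ofReal C) := by gcongr
      _ = _ := by rw [← ENNReal.ofReal_add hC hC, ← ENNReal.ofReal_mul (by positivity)]
  rw [rieszKernel, ENNReal.ofReal_le_ofReal_iff (by positivity)] at h1
  rw [Real.le_rpow_inv_iff_of_pos (norm_nonneg _) (by positivity) hq]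
  exact h1

/-! ### The repulsive-attractive case -/

theorem exists_bound_repulsiveAttractive [NeZero d] {p q : ℝ} (hpd : -(d : ℝ) < p) (hp : p < 0)
    (hq : 0 < q) : ∃ R : ℝ, 0 ≤ R ∧ ∃ m₀ : ℝ, 1 < m₀ ∧ ∀ m : ℝ, m₀ ≤ m →
      ∀ μ : Measure (EuclideanSpace ℝ (Fin d)), IsProbabilityMeasure μ →
        IsMomentMinimizer (repulsiveAttractivePotential d p q) m μ →
          ∃ a, ∀ᵐ x ∂μ, ‖x - a‖ ≤ R := by
  obtain ⟨s, hds, hsp⟩ := exists_between hpd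
  obtain ⟨r, hr, ν, hνp, hνle, hνr⟩ := exists_probabilityMeasure_le_volume (d := d)
  set K := repulsiveAttractivePotential d p q with hK
  have hA : 0 ≤ 1 / q := by positivity
  have hB : 0 ≤ -1 / p := by rw [neg_div, ← div_neg]; exact div_nonneg one_pos.le (by linarith)
  have hform : ∀ x, 1 * K x = 1 / q * ‖x‖ ^ q + -1 / p * ‖x‖ ^ p := fun x => by
    rw [hK, repulsiveAttractivePotential]; ring
  have hKnn : ∀ x, 0 ≤ 1 * K x := fun x => by rw [hform]; positivity
  have hKm : Measurable K :=
    ((measurable_norm.pow_const q).div_const q).sub ((measurable_norm.pow_const p).div_const p)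
  have hKe : ∀ x, K (-x) = K x := fun x => by simp [hK, repulsiveAttractivePotential]
  set κ := ∫⁻ y in Metric.ball (0 : EuclideanSpace ℝ (Fin d)) 1, rieszKernel s y with hκ
  have hκt : κ ≠ ∞ := setLIntegral_ball_rieszKernel_ne_top hds
  -- `V₀` bounds the interaction of the competitor `ν`: the `1` absorbs `densityPower m ν / m`, the
  -- `2` the remaining field. Then `M` bounds its energy, as `m ≥ 2` makes its entropy at most `1`.
  set V₀ := ENNReal.ofReal (1 / q) * ENNReal.ofReal ((2 * r) ^ q) +
    ENNReal.ofReal (-1 / p) * (κ + 1 + 2) with hV₀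
  have hV₀t : V₀ ≠ ∞ := by finiteness
  set M := 1 / 2 * V₀.toReal + 1 with hM
  have hM0 : 0 ≤ M := by positivity
  have hC0 : 0 ≤ q * (2 * M + 2 * (q * M)) := by positivity
  refine ⟨(2 ^ q * (q * (2 * M + 2 * (q * M)) + q * (2 * M + 2 * (q * M)))) ^ q⁻¹, by positivity,
    max 2 (s / (s - p)), lt_max_of_lt_left one_lt_two, fun m hm μ hμ hmin => ?_⟩
  have hm2 : 2 ≤ m := (le_max_left _ _).trans hm
  have hm1 : 1 < m := by linarith
  have hs : s ≤ p * (m / (m - 1)) := le_mul_div_sub_one hsp hm1 ((le_max_right _ _).trans hm)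
  have hνac : ν ≪ volume := Measure.absolutelyContinuous_of_le hνle
  have hνF := densityPower_le_one hνle hm1.le
  have hνF' : densityPower m ν ≠ ∞ := ne_top_of_le_ne_top ENNReal.one_ne_top hνF
  have hνV : mutualInteraction (fun x => ENNReal.ofReal (1 * K x)) ν ν ≤ V₀ := by
    rw [mutualInteraction_ofReal_eq hA hB hform, hV₀]
    gcongr
    · exact mutualInteraction_rieszKernel_le_of_ae_norm_le hq.le hνr
    · refine (mutualInteraction_rieszKernel_le hp hm1 hs hνac).trans ?_
      gcongr
      refine ENNReal.div_le_of_le_mul (hνF.trans ?_)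
      rw [one_mul, ENNReal.one_le_ofReal]
      exact hm1.le
  have hνV' := ne_top_of_le_ne_top hV₀t hνV
  have hνmom := lintegral_enorm_sq_le_of_ae_norm_le (μ := μ) hνr
  have hE : energy K m μ ≠ ⊤ := by
    refine ne_top_of_le_ne_top ?_ (hmin ν hνp hνmom)
    rw [energy_eq_coe (Or.inl rfl) hKnn hm1 hνac hνF' hνV']
    exact EReal.coe_ne_top _
  obtain ⟨hμac, hμF⟩ := energy_ne_top_imp hm1 hE
  have hreg : IsRegularMinimizer K 1 m μ := ⟨Or.inl rfl, hKnn, hKm, hKe, hm1, hμ, hμac, hμF, by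
    simpa using mutualInteraction_ne_top_of_energy_ne_top (fun x => by simpa using hKnn x) hE, hmin⟩
  have hen := hreg.energy_le hνmom hνac hνF' hνV'
  have hvir := hreg.virial hA hB hform
  have hVsum := mutualInteraction_ofReal_eq hA hB hform μ μ
  have hEL := hreg.ae_potential_le
  have hVt := hreg.interaction_ne_top
  set V := mutualInteraction (fun x => ENNReal.ofReal (1 * K x)) μ μ with hV
  set X := ENNReal.ofReal (1 / q) * mutualInteraction (rieszKernel q) μ μ with hX
  set Y := ENNReal.ofReal (-1 / p) * mutualInteraction (rieszKernel p) μ μ with hY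
  have hXV : X.toReal ≤ V.toReal := ENNReal.toReal_mono hVt (hVsum ▸ le_self_add)
  have hY0 : 0 ≤ Y.toReal := ENNReal.toReal_nonneg
  set F := (densityPower m μ).toReal with hF
  have hF0 : 0 ≤ F := ENNReal.toReal_nonneg
  have hupper : V.toReal ≤ 2 * M := by
    have h1 : (densityPower m ν).toReal / (m - 1) ≤ 1 := by
      rw [div_le_one (by linarith)]
      have := ENNReal.toReal_mono ENNReal.one_ne_top hνF
      rw [ENNReal.toReal_one] at this
      linarith
    have h2 := ENNReal.toReal_mono hV₀t hνV
    have h3 : 0 ≤ F / (m - 1) := div_nonneg hF0 (by linarith)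
    linarith
  -- In the virial identity the term with `p < 0` is nonpositive, so `d F ≤ q X / 2 ≤ q V / 2`.
  have hFle : F ≤ q * M := by
    have hd : (1 : ℝ) ≤ d := by exact_mod_cast Nat.one_le_iff_ne_zero.2 (NeZero.ne d)
    have h1 : F ≤ d * F := le_mul_of_one_le_left hF0 hd
    nlinarith
  have hΛ : V.toReal + m * F / (m - 1) ≤ 2 * M + 2 * (q * M) := by
    have h1 : m * F / (m - 1) ≤ 2 * F := by
      rw [div_le_iff₀ (by linarith)]
      nlinarith
    linarith
  have hpot : ∀ᵐ x ∂μ, ∫⁻ y, rieszKernel q (x - y) ∂μ ≤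
      ENNReal.ofReal (q * (2 * M + 2 * (q * M))) := by
    filter_upwards [hEL] with x hx
    calc ∫⁻ y, rieszKernel q (x - y) ∂μ
        ≤ ∫⁻ y, ENNReal.ofReal q * ENNReal.ofReal (1 * K (x - y)) ∂μ := by
          refine lintegral_mono fun y => ?_
          rw [← ENNReal.ofReal_mul hq.le, rieszKernel]
          refine ENNReal.ofReal_le_ofReal ?_
          rw [hform, mul_add, ← mul_assoc, mul_one_div_cancel hq.ne', one_mul]
          exact le_add_of_nonneg_right (by positivity)
      _ = ENNReal.ofReal q * ∫⁻ y, ENNReal.ofReal (1 * K (x - y)) ∂μ :=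
          lintegral_const_mul' _ _ ENNReal.ofReal_ne_top
      _ ≤ ENNReal.ofReal q * ENNReal.ofReal (2 * M + 2 * (q * M)) := by
          gcongr
          exact hx.trans (ENNReal.ofReal_le_ofReal hΛ)
      _ = _ := (ENNReal.ofReal_mul hq.le).symm
  obtain ⟨a, ha⟩ := hpot.exists
  refine ⟨a, ?_⟩
  filter_upwards [hpot] with x hx
  exact norm_sub_le_of_lintegral_rieszKernel_le hq hC0 hx ha

/-! ### The attractive case -/

theorem norm_le_sqrt_of_abs_coord_le {x : EuclideanSpace ℝ (Fin d)} {L : ℝ}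
    (h : ∀ i, |x i| ≤ L) : ‖x‖ ≤ √(d * L ^ 2) := by
  rw [EuclideanSpace.norm_eq]
  refine Real.sqrt_le_sqrt ?_
  calc ∑ i, ‖x i‖ ^ 2 ≤ ∑ _i : Fin d, L ^ 2 :=
        Finset.sum_le_sum fun i _ => pow_le_pow_left₀ (norm_nonneg _) (h i) 2
    _ = d * L ^ 2 := by simp

theorem exists_bound_attractive [NeZero d] {p : ℝ} (hpd : -(d : ℝ) < p) (hp : p < 0) :
    ∃ R : ℝ, 0 ≤ R ∧ ∃ m₀ : ℝ, 1 < m₀ ∧ ∀ m : ℝ, m₀ ≤ m →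
      ∀ μ : Measure (EuclideanSpace ℝ (Fin d)), IsProbabilityMeasure μ →
        IsMomentMinimizer (attractivePotential d p) m μ → ∃ a, ∀ᵐ x ∂μ, ‖x - a‖ ≤ R := by
  obtain ⟨s, hds, hsp⟩ := exists_between hpd
  obtain ⟨r, hr, ν, hνp, hνle, hνr⟩ := exists_probabilityMeasure_le_volume (d := d)
  set K := attractivePotential d p with hK
  set B := -1 / p with hBdef
  have hB : 0 < B := div_pos_of_neg_of_neg (by norm_num) hp
  have hBp : p * B = -1 := mul_div_cancel₀ _ hp.ne
  -- The first term is a dummy, with coefficient `0` and arbitrary exponent `1`, to fit the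
  -- two-power form of the virial identity.
  have hform : ∀ x, -1 * K x = 0 * ‖x‖ ^ (1 : ℝ) + B * ‖x‖ ^ p := fun x => by
    rw [hK, attractivePotential, hBdef]; ring
  have hform' : ∀ x, -1 * K x = B * ‖x‖ ^ p := fun x => by rw [hform]; ring
  have hKnn : ∀ x, 0 ≤ -1 * K x := fun x => by rw [hform']; positivity
  have hKm : Measurable K := (measurable_norm.pow_const p).div_const p
  have hKe : ∀ x, K (-x) = K x := fun x => by simp [hK, attractivePotential]
  have hanti : ∀ x y, x ≠ 0 → ‖x‖ < ‖y‖ → -1 * K y < -1 * K x := by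
    intro x y hx hxy
    rw [hform', hform']
    exact mul_lt_mul_of_pos_left (Real.rpow_lt_rpow_of_neg (norm_pos_iff.2 hx) hxy hp) hB
  have hVform : ∀ ρ : Measure (EuclideanSpace ℝ (Fin d)), IsProbabilityMeasure ρ →
      mutualInteraction (fun x => ENNReal.ofReal (-1 * K x)) ρ ρ =
        ENNReal.ofReal B * mutualInteraction (rieszKernel p) ρ ρ := by
    intro ρ hρ
    rw [mutualInteraction_ofReal_eq le_rfl hB.le hform, ENNReal.ofReal_zero, zero_mul, zero_add]
  set κ := ∫⁻ y in Metric.ball (0 : EuclideanSpace ℝ (Fin d)) 1, rieszKernel s y with hκ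
  have hκt : κ ≠ ∞ := setLIntegral_ball_rieszKernel_ne_top hds
  set w := (2 * r) ^ p with hw
  have hw0 : 0 < w := by positivity
  set Φ := 2 * κ.toReal + 4 with hΦ
  obtain ⟨ε, hε0, hε1, hε⟩ := exists_setLIntegral_ball_rieszKernel_le hds
    (η := ENNReal.ofReal (w / 32)) (by rw [ENNReal.ofReal_pos]; positivity)
  set t := (w / 32) ^ p⁻¹ with ht
  have ht0 : 0 < t := by positivity
  have htp : t ^ p = w / 32 := Real.rpow_inv_rpow (by positivity) hp.ne
  set δ := w / 32 / ε ^ p with hδ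
  have hδ0 : 0 < δ := by positivity
  set L := (3 / δ + 1) * t with hL
  refine ⟨√(d * L ^ 2), Real.sqrt_nonneg _,
    -- The thresholds give, in order, `m / (m - 1) ≤ 3 / 2`, admissibility of `s` in Young's
    -- inequality, competitor entropy at most `B w / 4`, and `F / m ≤ w / 32`.
    max (max 3 (s / (s - p))) (max (4 / (B * w) + 1) (Φ * 32 / w)),
    lt_max_of_lt_left (lt_max_of_lt_left (by norm_num)), fun m hm μ hμ hmin => ?_⟩
  have hm3 : 3 ≤ m := (le_max_left _ _).trans ((le_max_left _ _).trans hm)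
  have hm1 : 1 < m := by linarith
  have hs : s ≤ p * (m / (m - 1)) := le_mul_div_sub_one hsp hm1
    ((le_max_right _ _).trans ((le_max_left _ _).trans hm))
  have hmw : 4 / (B * w) + 1 ≤ m := (le_max_left _ _).trans ((le_max_right _ _).trans hm)
  have hmΦ : Φ * 32 / w ≤ m := (le_max_right _ _).trans ((le_max_right _ _).trans hm)
  have hfin : ∀ ρ : Measure (EuclideanSpace ℝ (Fin d)), IsProbabilityMeasure ρ → ρ ≪ volume →
      densityPower m ρ ≠ ∞ →
        mutualInteraction (fun x => ENNReal.ofReal (-1 * K x)) ρ ρ ≠ ∞ := by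
    intro ρ hρ hac hF
    rw [hVform ρ hρ]
    refine ENNReal.mul_ne_top ENNReal.ofReal_ne_top (ne_top_of_le_ne_top ?_
      (mutualInteraction_rieszKernel_le hp hm1 hs hac))
    have h0 : ENNReal.ofReal m ≠ 0 := by
      rw [Ne, ENNReal.ofReal_eq_zero]; linarith
    have := ENNReal.div_ne_top hF h0
    finiteness
  have hνac : ν ≪ volume := Measure.absolutelyContinuous_of_le hνle
  have hνF := densityPower_le_one hνle hm1.le
  have hνF' : densityPower m ν ≠ ∞ := ne_top_of_le_ne_top ENNReal.one_ne_top hνF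
  have hνV' := hfin ν hνp hνac hνF'
  have hνmom := lintegral_enorm_sq_le_of_ae_norm_le (μ := μ) hνr
  have hE : energy K m μ ≠ ⊤ := by
    refine ne_top_of_le_ne_top ?_ (hmin ν hνp hνmom)
    rw [energy_eq_coe (Or.inr rfl) hKnn hm1 hνac hνF' hνV']
    exact EReal.coe_ne_top _
  obtain ⟨hμac, hμF⟩ := energy_ne_top_imp hm1 hE
  have hreg : IsRegularMinimizer K (-1) m μ :=
    ⟨Or.inr rfl, hKnn, hKm, hKe, hm1, hμ, hμac, hμF, hfin μ hμ hμac hμF, hmin⟩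
  have hen := hreg.energy_le hνmom hνac hνF' hνV'
  have hvir := hreg.virial le_rfl hB.le hform
  have hEL := hreg.ae_le_potential
  rw [ENNReal.ofReal_zero, zero_mul, ENNReal.toReal_zero, mul_zero, zero_add] at hvir
  rw [hVform μ hμ] at hEL hen
  rw [hVform ν hνp] at hen hνV'
  have hWle := mutualInteraction_rieszKernel_le hp hm1 hs hμac
  have hmul : ∀ W : ℝ≥0∞, (ENNReal.ofReal B * W).toReal = B * W.toReal := fun W => by
    rw [ENNReal.toReal_mul, ENNReal.toReal_ofReal hB.le]
  rw [hmul] at hvir hEL hen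
  rw [hmul] at hen
  set W := (mutualInteraction (rieszKernel p) μ μ).toReal with hW
  have hFof : densityPower m μ = ENNReal.ofReal (densityPower m μ).toReal :=
    (ENNReal.ofReal_toReal hμF).symm
  set F := (densityPower m μ).toReal with hF
  have hF0 : 0 ≤ F := ENNReal.toReal_nonneg
  have hW0 : 0 ≤ W := ENNReal.toReal_nonneg
  have hd : (1 : ℝ) ≤ d := by exact_mod_cast Nat.one_le_iff_ne_zero.2 (NeZero.ne d)
  have hvir' : W / 2 = d * F := by
    have h1 : p * (B * W) = -W := by rw [← mul_assoc, hBp]; ring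
    rw [h1] at hvir
    linarith
  -- The virial identity and the Young bound combine to `2 d F = W ≤ κ + F / m + 2`, where `F / m`
  -- is absorbed on the left.
  have hFΦ : F ≤ Φ := by
    have h1 : W ≤ κ.toReal + F / m + 2 := by
      have h2 : κ + densityPower m μ / ENNReal.ofReal m + 2 =
          ENNReal.ofReal (κ.toReal + F / m + 2) := by
        rw [ENNReal.ofReal_add (by positivity) (by norm_num), ENNReal.ofReal_add (by positivity)
          (by positivity), ENNReal.ofReal_toReal hκt, ENNReal.ofReal_div_of_pos (by linarith),
          ← hFof, ENNReal.ofReal_ofNat]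
      rw [← hκ, h2] at hWle
      exact ENNReal.toReal_le_of_le_ofReal (by positivity) hWle
    have h3 : F / m ≤ F / 2 := by gcongr; linarith
    have h4 : F ≤ d * F := le_mul_of_one_le_left hF0 hd
    linarith
  have hBW : B * w / 2 ≤ B * W := by
    have h1 : (densityPower m ν).toReal / (m - 1) ≤ B * w / 4 := by
      rw [div_le_iff₀ (by linarith)]
      have h2 := ENNReal.toReal_mono ENNReal.one_ne_top hνF
      rw [ENNReal.toReal_one] at h2
      have h3 : 4 / (B * w) ≤ m - 1 := by linarith
      rw [div_le_iff₀ (by positivity)] at h3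
      linarith
    have h4 : w ≤ (mutualInteraction (rieszKernel p) ν ν).toReal := by
      refine (ENNReal.ofReal_le_iff_le_toReal ?_).1
        (le_mutualInteraction_rieszKernel_of_ae_norm_le hp hνac hνr)
      intro h0
      rw [h0, ENNReal.mul_top (by simpa using hB)] at hνV'
      exact hνV' rfl
    have h5 : B * w ≤ B * (mutualInteraction (rieszKernel p) ν ν).toReal := by gcongr
    have h6 : 0 ≤ F / (m - 1) := div_nonneg hF0 (by linarith)
    linarith
  -- From `p > -d` comes `d B ≥ 1`, so the virial identity yields `F ≤ B W / 2`. With `m / (m - 1) ≤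
  -- 3 / 2` at least a quarter of `B W ≥ B w / 2` survives.
  have hlam : B * w / 8 ≤ B * W - m * F / (m - 1) := by
    have h1 : m * F / (m - 1) ≤ 3 / 2 * F := by
      rw [div_le_iff₀ (by linarith)]
      nlinarith
    have h2 : F ≤ B * W / 2 := by
      have h3 : 1 ≤ d * B := by nlinarith
      have h4 : W ≤ d * B * W := le_mul_of_one_le_left hW0 h3
      have h5 : d * F ≤ d * (B * W / 2) := by linarith
      exact le_of_mul_le_mul_left h5 (by linarith)
    linarith
  have hball : ∀ᵐ x ∂μ, ENNReal.ofReal δ ≤ μ (Metric.ball x t) := by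
    filter_upwards [hEL] with x hx
    have h1 : ENNReal.ofReal B * ENNReal.ofReal (w / 8) ≤
        ENNReal.ofReal B * ∫⁻ y, rieszKernel p (x - y) ∂μ := by
      calc ENNReal.ofReal B * ENNReal.ofReal (w / 8) = ENNReal.ofReal (B * w / 8) := by
            rw [← ENNReal.ofReal_mul hB.le, mul_div_assoc]
        _ ≤ _ := (ENNReal.ofReal_le_ofReal hlam).trans hx
        _ = _ := by
            rw [← lintegral_const_mul' _ _ ENNReal.ofReal_ne_top]
            refine lintegral_congr fun y => ?_
            rw [hform', rieszKernel, ENNReal.ofReal_mul hB.le]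
    rw [ENNReal.mul_le_mul_iff_right (by simpa using hB) ENNReal.ofReal_ne_top] at h1
    have h2 := h1.trans (lintegral_rieszKernel_sub_le hp hm1 hs hε0 hε1 ht0 hμac x)
    have h3 : densityPower m μ / ENNReal.ofReal m ≤ ENNReal.ofReal (w / 32) := by
      rw [hFof, ← ENNReal.ofReal_div_of_pos (by linarith)]
      refine ENNReal.ofReal_le_ofReal ?_
      rw [div_le_iff₀ (by linarith)]
      rw [div_le_iff₀ hw0] at hmΦ
      linarith
    -- Of the four shares `w / 32` in `w / 8`, three go to the near kernel, the entropy term and the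
    -- far field; the last is left for the mass of the ball, whence `δ`.
    have h4 : ENNReal.ofReal (w / 8) ≤ ENNReal.ofReal (w / 32) + ENNReal.ofReal (w / 32) +
        ENNReal.ofReal (ε ^ p) * μ (Metric.ball x t) + ENNReal.ofReal (w / 32) := by
      refine h2.trans ?_
      rw [htp]
      gcongr
    rw [← ENNReal.ofReal_toReal (measure_ne_top μ (Metric.ball x t)),
      ← ENNReal.ofReal_mul (by positivity), ← ENNReal.ofReal_add (by positivity) (by positivity),
      ← ENNReal.ofReal_add (by positivity) (by positivity),
      ← ENNReal.ofReal_add (by positivity) (by positivity),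
      ENNReal.ofReal_le_ofReal_iff (by positivity)] at h4
    rw [← ENNReal.ofReal_toReal (measure_ne_top μ (Metric.ball x t))]
    refine ENNReal.ofReal_le_ofReal ?_
    rw [hδ, div_le_iff₀ (by positivity)]
    linarith
  have hcoord : ∀ i : Fin d, ∃ a : ℝ, ∀ᵐ x ∂μ, |x i - a| ≤ L := fun i =>
    exists_ae_abs_coord_sub_le ht0 hδ0 hball fun c hc => by
      have hb : 2 * (t / 2) = t := by ring
      have := hreg.measure_lt_eq_zero_or hanti hfin (i := i) (c := c) (b := t / 2) (by positivity)
      rw [hb] at this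
      exact this hc
  choose a ha using hcoord
  refine ⟨WithLp.toLp 2 a, ?_⟩
  filter_upwards [ae_all_iff.2 ha] with x hx
  exact norm_le_sqrt_of_abs_coord_le fun i => by simpa using hx i

end AggregationDiffusion

theorem theorem1p2 (d : ℕ) (K : EuclideanSpace ℝ (Fin d) → ℝ)
    (hK : (∃ p : ℝ, -(d : ℝ) < p ∧ p < 0 ∧ K = attractivePotential d p) ∨
      (∃ p q : ℝ, -(d : ℝ) < p ∧ p < 0 ∧ 0 < q ∧ K = repulsiveAttractivePotential d p q)) :
    ∃ R : ℝ, 0 < R ∧ ∃ m₀ : ℝ, 1 < m₀ ∧ ∀ m : ℝ, m₀ ≤ m →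
      ∀ μ : ProbabilityMeasure (EuclideanSpace ℝ (Fin d)),
        (IsEnergyMinimizer K m (finiteSecondMoment d) μ ∨ IsEnergyMinimizer K m Set.univ μ) →
          ∃ a : EuclideanSpace ℝ (Fin d),
            ((μ : Measure (EuclideanSpace ℝ (Fin d))).map (fun x => x - a)).support ⊆
              Metric.ball 0 R := by
  -- The range `-d < p < 0` is empty for `d = 0`.
  have hd : NeZero d := by
    constructor
    rintro rfl
    rcases hK with ⟨p, h1, h2, -⟩ | ⟨p, q, h1, h2, -⟩ <;>
    · rw [Nat.cast_zero] at h1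
      linarith
  have hbound : ∃ R : ℝ, 0 ≤ R ∧ ∃ m₀ : ℝ, 1 < m₀ ∧ ∀ m : ℝ, m₀ ≤ m →
      ∀ μ : Measure (EuclideanSpace ℝ (Fin d)), IsProbabilityMeasure μ →
        IsMomentMinimizer K m μ → ∃ a, ∀ᵐ x ∂μ, ‖x - a‖ ≤ R := by
    rcases hK with ⟨p, h1, h2, rfl⟩ | ⟨p, q, h1, h2, h3, rfl⟩
    · exact exists_bound_attractive h1 h2
    · exact exists_bound_repulsiveAttractive h1 h2 h3
  obtain ⟨R, hR, m₀, hm₀, h⟩ := hbound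
  refine ⟨R + 1, by linarith, m₀, hm₀, fun m hm μ hμ => ?_⟩
  obtain ⟨a, ha⟩ := h m hm μ inferInstance (IsEnergyMinimizer.isMomentMinimizer hμ)
  exact ⟨a, support_map_sub_subset_ball ha⟩
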